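/- Fix $\gamma\in\mathbb R$. For $N\ge 0$ let $S_N$ act on $\mathbb R^N$ by permuting coordinates, $(wx)_j=x_{w^{-1}(j)}$, and on functions $f:\mathbb R^N\to\mathbb C$ by $(wf)(x)=f(w^{-1}x)$; let $s_j$ be the transposition of $j$ and $j+1$, and $\mathbb R^N_+=\{x: x_1>\dots>x_N\}$. For continuous $f$ put $(I_{jk}f)(x)=\int_0^{x_j-x_k}f(x-y(e_j-e_k))\,dy$, $s_j^\gamma=s_j+\gamma I_{j\,j+1}$, and $w^\gamma=s_{i_1}^\gamma\cdots s_{i_l}^\gamma$ for $w=s_{i_1}\cdots s_{i_l}$ (independent of the decomposition). The propagation operator $P^\gamma_{(N)}$ maps $f$ to the continuous function given by $w^{-1}w^\gamma f$ on $w^{-1}\mathbb R^N_+$ for every $w\in S_N$. For $\lambda\in\mathbb C^N$ let $\psi_\lambda=P^\gamma_{(N)}e^{i\lambda}$ with $e^{i\lambda}(x)=e^{i\sum_j\lambda_jx_j}$, and let $\mathfrak z_N=\operatorname{span}_{\mathbb C}\{\psi_\lambda:\lambda\in\mathbb C^N\}$. For $\mu\in\mathbb C$ and $\epsilon=\pm$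 define, for functions $f$ on $\mathbb R^N$, the function on $\mathbb R^{N+1}$ $$b^\epsilon_\mu f=\sum_{n=0}^N\gamma^n\sum_{\mathbf i}\hat e^\epsilon_{\mu;\mathbf i}f,$$ where $\mathbf i=(i_1,\dots,i_n)$ runs over $n$-tuples of distinct elements of $\{1,\dots,N\}$. Here $(\hat e^-_{\mu;\mathbf i}f)(x)=0$ unless $x_{N+1}>x_{i_1}>\dots>x_{i_n}$, in which case, with $i_0=N+1$, $$(\hat e^-_{\mu;\mathbf i}f)(x)=e^{i\mu x_{N+1}}\int_{x_{i_1}}^{x_{i_0}}dy_1\cdots\int_{x_{i_n}}^{x_{i_{n-1}}}dy_n\,\Big(\prod_{m=1}^n e^{i\mu(x_{i_m}-y_m)}\Big)f(x'),$$ where $x'$ is $(x_1,\dots,x_N)$ with its $i_m$-th entry replaced by $y_m$ for each $m$. Likewise $(\hat e^+_{\mu;\mathbf i}f)(x)=0$ unless $x_{i_1+1}>\dots>x_{i_n+1}>x_1$, in which case, with $k_m=i_m+1$ for $m\le n$ and $k_{n+1}=1$, $$(\hat e^+_{\mu;\mathbf i}f)(x)=e^{i\mu x_1}\int_{x_{k_2}}^{x_{k_1}}dy_1\cdots\int_{x_{k_{n+1}}}^{x_{k_n}}dy_n\,\Big(\prod_{m=1}^n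 e^{i\mu(x_{k_m}-y_m)}\Big)f(x''),$$ where $x''$ is $(x_2,\dots,x_{N+1})$ with its $i_m$-th entry replaced by $y_m$ for each $m$. **Proposition.** Each $b^\epsilon_\mu$ restricts to a linear map $\mathfrak z_N\to\mathfrak z_{N+1}$ for every $N\ge0$, and for all $N\ge0$ and $\mu,\nu\in\mathbb C$: 1. $[b^+_\mu,b^-_\nu]=0$ as maps $\mathfrak z_N\to\mathfrak z_{N+2}$. 2. Let $\epsilon=\pm$, and let $s^+=s_1$, $s^-=s_{N+1}$ in $S_{N+2}$. If $\mu\ne\nu$, then as maps $\mathfrak z_N\to\mathfrak z_{N+2}$ (in particular $s^\epsilon b^\epsilon_\mu b^\epsilon_\nu$ maps $\mathfrak z_N$ to $\mathfrak z_{N+2}$), $$s^\epsilon b^\epsilon_\mu b^\epsilon_\nu-b^\epsilon_\nu b^\epsilon_\mu=\frac{-\epsilon i\gamma}{\mu-\nu}\,[b^\epsilon_\mu,b^\epsilon_\nu].$$ 3. For $\mu=\nu$ and every $f\in\mathfrak z_N$, the limit $\lim_{\nu\to\mu}\frac{1}{\mu-\nu}[b^\epsilon_\mu,b^\epsilon_\nu]f$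 exists locally uniformly on $\mathbb R^{N+2}$, and $$s^\epsilon b^\epsilon_\mu b^\epsilon_\mu f-b^\epsilon_\mu b^\epsilon_\mu f=-\epsilon i\gamma\lim_{\nu\to\mu}\frac{[b^\epsilon_\mu,b^\epsilon_\nu]f}{\mu-\nu}$$ as functions on $\mathbb R^{N+2}$. -/

import Mathlib

open Filter Topology

noncomputable section

namespace QNLS

/-- Complex-valued functions on `ℝ^N`. -/
abbrev Fun (N : ℕ) : Type := (Fin N → ℝ) → ℂ

/-- The action `(w f)(x) = f (w⁻¹ x)` of the symmetric group on functions, where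
`(w x)_j = x_{w⁻¹ j}`, so that `w⁻¹ x = x ∘ w`. -/
def permAct {N : ℕ} (w : Equiv.Perm (Fin N)) (f : Fun N) : Fun N :=
  fun x => f (x ∘ w)

/-- `(I_{jk} f)(x) = ∫_0^{x_j - x_k} f (x - y (e_j - e_k)) dy`. -/
def intOp {N : ℕ} (j k : Fin N) (f : Fun N) : Fun N :=
  fun x => ∫ y in (0 : ℝ)..(x j - x k),
    f (x - y • (Pi.single j (1 : ℝ) - Pi.single k (1 : ℝ)))

/-- Pairs `(j, j + 1)` of consecutive indices, which label the simple transpositions. -/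
abbrev Simple (N : ℕ) : Type := {p : Fin N × Fin N // (p.1 : ℕ) + 1 = (p.2 : ℕ)}

/-- The simple transposition `s_j`, for `p = (j, j + 1)`. -/
def simpleSwap {N : ℕ} (p : Simple N) : Equiv.Perm (Fin N) :=
  Equiv.swap p.1.1 p.1.2

/-- The integral-reflection operator `s_j^γ = s_j + γ I_{j, j+1}`, for `p = (j, j + 1)`. -/
def intRefl (γ : ℝ) {N : ℕ} (p : Simple N) (f : Fun N) : Fun N :=
  permAct (simpleSwap p) f + (γ : ℂ) • intOp p.1.1 p.1.2 f

/-- Every permutation is a product of simple transpositions. -/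
theorem exists_word {N : ℕ} (w : Equiv.Perm (Fin N)) :
    ∃ l : List (Simple N), (l.map simpleSwap).prod = w := by
  cases N with
  | zero => exact ⟨[], Subsingleton.elim _ _⟩
  | succ n =>
    have hw : w ∈ Submonoid.closure
        (Set.range fun i : Fin n => Equiv.swap i.castSucc i.succ) := by
      rw [Equiv.Perm.mclosure_swap_castSucc_succ]
      trivial
    induction hw using Submonoid.closure_induction with
    | mem x hx =>
      obtain ⟨i, rfl⟩ := hx
      exact ⟨[⟨(i.castSucc, i.succ), by simp⟩], by simp [simpleSwap]⟩
    | one => exact ⟨[], by simp⟩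
    | mul x y _ _ hx hy =>
      obtain ⟨a, rfl⟩ := hx
      obtain ⟨b, rfl⟩ := hy
      exact ⟨a ++ b, by simp⟩

/-- A decomposition `w = s_{i_1} ⋯ s_{i_l}` into simple transpositions. -/
def word {N : ℕ} (w : Equiv.Perm (Fin N)) : List (Simple N) :=
  (exists_word w).choose

/-- `w^γ = s_{i_1}^γ ⋯ s_{i_l}^γ` for a decomposition `w = s_{i_1} ⋯ s_{i_l}`. On continuous
functions the operators `s_j^γ` satisfy the relations of the simple transpositions, so that the
result does not depend on the decomposition. -/
def intReflPerm (γ : ℝ) {N : ℕ} (w : Equiv.Perm (Fin N)) (f : Fun N) : Fun N :=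
  (word w).foldr (intRefl γ) f

/-- The permutation `w` for which `w x = x ∘ w⁻¹` is weakly decreasing (ties, which occur only
on the hyperplanes `x_j = x_k`, are broken by the order of the indices). -/
def chamber {N : ℕ} (x : Fin N → ℝ) : Equiv.Perm (Fin N) :=
  (Tuple.sort fun j => -x j)⁻¹

/-- For `x` in the alcove `w⁻¹ ℝ^N_+`, where `ℝ^N_+` is the set of strictly decreasing vectors,
`chamber x` is `w`. -/
theorem chamber_eq {N : ℕ} {x : Fin N → ℝ} {w : Equiv.Perm (Fin N)}
    (hx : StrictAnti fun j => x (w⁻¹ j)) : chamber x = w := by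
  have h : w⁻¹ = Tuple.sort fun j => -x j := by
    rw [Tuple.eq_sort_iff]
    refine ⟨fun a b hab => neg_le_neg (hx.antitone hab), fun i j hij h => ?_⟩
    exact absurd (neg_injective h) (hx hij).ne'
  rw [chamber, ← h, inv_inv]

/-- The propagation operator: `P^γ f = w⁻¹ w^γ f` on the alcove `w⁻¹ ℝ^N_+`, extended to the
hyperplanes by the formula of an adjacent alcove. As `I_{jk} f` vanishes where `x_j = x_k`, the
formulas of all adjacent alcoves agree there for continuous `f`, so that this is the continuous
extension. -/
def propagation (γ : ℝ) {N : ℕ} (f : Fun N) : Fun N :=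
  fun x => permAct (chamber x)⁻¹ (intReflPerm γ (chamber x) f) x

theorem propagation_eq_of_mem_alcove (γ : ℝ) {N : ℕ} (f : Fun N) {x : Fin N → ℝ}
    {w : Equiv.Perm (Fin N)} (hx : StrictAnti fun j => x (w⁻¹ j)) :
    propagation γ f x = permAct w⁻¹ (intReflPerm γ w f) x := by
  rw [propagation, chamber_eq hx]

/-- The plane wave `e^{iλ}(x) = exp (i ∑ λ_j x_j)`. -/
def planeWave {N : ℕ} (l : Fin N → ℂ) : Fun N :=
  fun x => Complex.exp (Complex.I * ∑ j, l j * (x j : ℂ))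

/-- The non-symmetric wavefunction `ψ_λ = P^γ e^{iλ}`. -/
def psi (γ : ℝ) {N : ℕ} (l : Fin N → ℂ) : Fun N :=
  propagation γ (planeWave l)

/-- `𝔷_N`, the span of the non-symmetric wavefunctions. -/
def zSpan (γ : ℝ) (N : ℕ) : Submodule ℂ (Fun N) :=
  Submodule.span ℂ (Set.range fun l : Fin N → ℂ => psi γ l)

/-- The iterated integral
`∫_{a_1}^{c_1} dy_1 ⋯ ∫_{a_n}^{c_n} dy_n F (y_1, …, y_n)`. -/
def iterInt : (n : ℕ) → (Fin n → ℝ) → (Fin n → ℝ) → ((Fin n → ℝ) → ℂ) → ℂ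
  | 0, _, _, F => F Fin.elim0
  | n + 1, a, c, F => ∫ t in (a 0)..(c 0),
      iterInt n (Fin.tail a) (Fin.tail c) fun y => F (Fin.cons t y)

/-- `x` with `x_{i_m}` replaced by `y_m` for all `m`. -/
def replaceAt {N n : ℕ} (i : Fin n ↪ Fin N) (y : Fin n → ℝ) (x : Fin N → ℝ) : Fin N → ℝ :=
  Function.extend i y x

/-- For `i = (i_1, …, i_n)`, the labels `(i_1 + 1, …, i_n + 1, 1)` in `{1, …, N + 1}`. -/
def plusChain {N n : ℕ} (i : Fin n ↪ Fin N) : Fin (n + 1) → Fin (N + 1) :=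
  Fin.snoc (α := fun _ => Fin (N + 1)) (fun m => (i m).succ) 0

/-- For `i = (i_1, …, i_n)`, the labels `(N + 1, i_1, …, i_n)` in `{1, …, N + 1}`. -/
def minusChain {N n : ℕ} (i : Fin n ↪ Fin N) : Fin (n + 1) → Fin (N + 1) :=
  Fin.cons (α := fun _ => Fin (N + 1)) (Fin.last N) (fun m => (i m).castSucc)

open Classical in
/-- The elementary creation operator `ê⁺_{μ;i}`. -/
def ePlus (μ : ℂ) {N n : ℕ} (i : Fin n ↪ Fin N) (f : Fun N) : Fun (N + 1) :=
  fun x =>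
    if ∀ m : Fin n, x (plusChain i m.succ) < x (plusChain i m.castSucc) then
      Complex.exp (Complex.I * μ * (x 0 : ℂ)) *
        iterInt n (fun m => x (plusChain i m.succ)) (fun m => x (plusChain i m.castSucc))
          (fun y => (∏ m, Complex.exp (Complex.I * μ * ((x (i m).succ - y m : ℝ) : ℂ))) *
            f (replaceAt i y fun j => x j.succ))
    else 0

open Classical in
/-- The elementary creation operator `ê⁻_{μ;i}`. -/
def eMinus (μ : ℂ) {N n : ℕ} (i : Fin n ↪ Fin N) (f : Fun N) : Fun (N + 1) :=
  fun x =>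
    if ∀ m : Fin n, x (minusChain i m.succ) < x (minusChain i m.castSucc) then
      Complex.exp (Complex.I * μ * (x (Fin.last N) : ℂ)) *
        iterInt n (fun m => x (minusChain i m.succ)) (fun m => x (minusChain i m.castSucc))
          (fun y => (∏ m, Complex.exp (Complex.I * μ * ((x (i m).castSucc - y m : ℝ) : ℂ))) *
            f (replaceAt i y fun j => x j.castSucc))
    else 0

/-- The sign `ε = ±`. -/
inductive Sgn : Type
  | plus : Sgn
  | minus : Sgn

/-- The sign as a number. -/
def Sgn.val : Sgn → ℂ
  | .plus => 1
  | .minus => -1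

/-- `ê^ε_{μ;i}`. -/
def elemCreation (ε : Sgn) (μ : ℂ) {N n : ℕ} (i : Fin n ↪ Fin N) (f : Fun N) : Fun (N + 1) :=
  match ε with
  | .plus => ePlus μ i f
  | .minus => eMinus μ i f

/-- The non-symmetric creation operator
`b^ε_μ = ∑_{n = 0}^N γ^n ∑_i ê^ε_{μ;i}`, where `i` runs over the `n`-tuples of distinct elements
of `{1, …, N}`. -/
def creation (γ : ℝ) (ε : Sgn) (μ : ℂ) {N : ℕ} (f : Fun N) : Fun (N + 1) :=
  ∑ n ∈ Finset.range (N + 1), (γ : ℂ) ^ n • ∑ i : Fin n ↪ Fin N, elemCreation ε μ i f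

/-- `s⁺ = s_1` and `s⁻ = s_{N+1}`, the transpositions of the first two and of the last two
indices in `S_{N+2}`. -/
def edgeSwap (N : ℕ) : Sgn → Equiv.Perm (Fin (N + 2))
  | .plus => Equiv.swap 0 1
  | .minus => Equiv.swap (Fin.last N).castSucc (Fin.last (N + 1))

end QNLS

end

/-! Everything reduces to two formulas: $b^-_\mu\psi_\lambda=\psi_{(\lambda,\mu)}$ and
$b^+_\mu\psi_\lambda=\psi_{(\mu,\lambda)}$ (`creation_minus_psi`, `creation_plus_psi`). They give
invariance of the spans, and also commutation of opposite signs, since adjoining entries at the two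
ends commutes. The quadratic relations become the exchange relation
$(\lambda_j-\lambda_{j+1})(s_j\psi_\lambda-\psi_{s_j\lambda})=-i\gamma(\psi_\lambda-\psi_{s_j\lambda})$
at the first or last pair of indices.

This relation, together with $\psi_\lambda=e^{i\lambda}$ on the closed fundamental alcove and
continuity in $\lambda$, characterizes the family (`psi_eq_of_exchange`). For distinct $\lambda_j$,
the operators $s_j^\gamma$ act on the span of the $e^{iv\lambda}$ by the same coefficients as the
$s_j$ on the competing family; density of such $\lambda$ removes the restriction. It remains to
verify the characterization for $b^-_{\lambda_N}\cdots b^-_{\lambda_1}1$. Its only hard point is the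
exchange relation for $b^-_\mu b^-_\nu f$ with $f$ merely continuous (`twoCreation_exchange`).

For that, the sum over chains is rewritten as an integral equation in the new variable, with empty
integrals instead of case distinctions. It yields one-sided derivatives of $b^-_\mu b^-_\nu f$ in
each of the last two variables. By induction on the number of coordinates below these variables, the
defect of the relation, suitably normalized, has right derivative zero and vanishes on the diagonal.

The operators $b^+$ follow by the reflection $x\mapsto(-x_N,\dots,-x_1)$, under which the family
$\psi$ is stable by the same characterization. When $\mu=\nu$, the divided difference is $P^\gamma$
of an integral of a plane wave, hence regular at $\nu=\mu$, and the relation passes to the limit. -/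

namespace QNLS

open Function

/-! ### One-variable waves and iterated integrals -/

/-- The one-variable plane wave `t ↦ exp (i μ t)`. -/
noncomputable def wave (μ : ℂ) (t : ℝ) : ℂ := Complex.exp (Complex.I * μ * (t : ℂ))

theorem wave_add (μ : ℂ) (s t : ℝ) : wave μ (s + t) = wave μ s * wave μ t := by
  simp only [wave, ← Complex.exp_add]
  push_cast
  ring_nf

@[simp]
theorem wave_zero (μ : ℂ) : wave μ 0 = 1 := by simp [wave]

theorem wave_sub (μ : ℂ) (s t : ℝ) : wave μ (s - t) = wave μ s * wave μ (-t) := by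
  rw [sub_eq_add_neg, wave_add]

theorem wave_neg_mul_self (μ : ℂ) (s : ℝ) : wave μ (-s) * wave μ s = 1 := by
  rw [← wave_add, neg_add_cancel, wave_zero]

@[fun_prop]
theorem continuous_wave {X : Type*} [TopologicalSpace X] {μ : X → ℂ} {s : X → ℝ}
    (hμ : Continuous μ) (hs : Continuous s) : Continuous fun x => wave (μ x) (s x) := by
  unfold QNLS.wave
  fun_prop

theorem hasDerivAt_wave (μ : ℂ) (t : ℝ) :
    HasDerivAt (wave μ) (Complex.I * μ * wave μ t) t := by
  have h : HasDerivAt (fun s : ℝ => Complex.I * μ * (s : ℂ)) (Complex.I * μ * 1) t :=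
    (Complex.ofRealCLM.hasDerivAt (x := t)).const_mul (Complex.I * μ)
  have h' := h.cexp
  rw [mul_one, mul_comm (Complex.exp _)] at h'
  exact h'

theorem continuous_intervalIntegral {X : Type*} [TopologicalSpace X] [FirstCountableTopology X]
    [LocallyCompactSpace X] {F : X → ℝ → ℂ} (hF : Continuous fun q : X × ℝ => F q.1 q.2)
    {a b : X → ℝ} (ha : Continuous a) (hb : Continuous b) :
    Continuous fun x => ∫ t in a x..b x, F x t := by
  have hi : ∀ x u v, IntervalIntegrable (F x) MeasureTheory.volume u v := fun x u v =>
    (hF.comp (Continuous.prodMk_right x)).intervalIntegrable u v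
  have h : (fun x => ∫ t in a x..b x, F x t) =
      fun x => (∫ t in (0 : ℝ)..b x, F x t) - ∫ t in (0 : ℝ)..a x, F x t := by
    funext x
    rw [intervalIntegral.integral_interval_sub_left (hi ..) (hi ..)]
  rw [h]
  exact (intervalIntegral.continuous_parametric_intervalIntegral_of_continuous hF hb).sub
    (intervalIntegral.continuous_parametric_intervalIntegral_of_continuous hF ha)

theorem intervalIntegral_swap {F : ℝ → ℝ → ℂ} (hF : Continuous fun q : ℝ × ℝ => F q.1 q.2)
    (a b c d : ℝ) :
    ∫ x in a..b, ∫ y in c..d, F x y = ∫ y in c..d, ∫ x in a..b, F x y := by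
  refine MeasureTheory.intervalIntegral_intervalIntegral_swap ?_
  refine MeasureTheory.IntegrableOn.mono_set (t := Set.uIcc a b ×ˢ Set.uIcc c d) ?_
    (Set.prod_mono Set.uIoc_subset_uIcc Set.uIoc_subset_uIcc)
  exact hF.continuousOn.integrableOn_compact (isCompact_uIcc.prod isCompact_uIcc)

theorem iterInt_const_mul (k : ℂ) (n : ℕ) (a c : Fin n → ℝ) (F : (Fin n → ℝ) → ℂ) :
    iterInt n a c (fun y => k * F y) = k * iterInt n a c F := by
  induction n with
  | zero => rfl
  | succ n ih => simp only [iterInt, ih, intervalIntegral.integral_const_mul]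

theorem continuous_iterInt {X : Type*} [TopologicalSpace X] [FirstCountableTopology X]
    [LocallyCompactSpace X] (n : ℕ) {a c : X → Fin n → ℝ} {F : X → (Fin n → ℝ) → ℂ}
    (ha : Continuous a) (hc : Continuous c)
    (hF : Continuous fun q : X × (Fin n → ℝ) => F q.1 q.2) :
    Continuous fun x => iterInt n (a x) (c x) (F x) := by
  induction n generalizing X with
  | zero =>
    exact hF.comp (continuous_id.prodMk continuous_const)
  | succ n ih =>
    simp only [iterInt]
    refine continuous_intervalIntegral ?_ (by fun_prop) (by fun_prop)
    refine ih (X := X × ℝ) (by unfold Fin.tail; fun_prop) (by unfold Fin.tail; fun_prop) ?_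
    exact hF.comp ((continuous_fst.comp continuous_fst).prodMk
      (Continuous.finCons (continuous_snd.comp continuous_fst) continuous_snd))

theorem iterInt_succ_last (n : ℕ) (a c : Fin (n + 1) → ℝ) {F : (Fin (n + 1) → ℝ) → ℂ}
    (hF : Continuous F) :
    iterInt (n + 1) a c F = ∫ t in a (Fin.last n)..c (Fin.last n),
      iterInt n (Fin.init a) (Fin.init c) fun y =>
        F (Fin.snoc (α := fun _ => ℝ) y t) := by
  induction n with
  | zero =>
    simp only [iterInt]
    refine intervalIntegral.integral_congr fun t _ => ?_
    refine congrArg F ?_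
    funext j
    fin_cases j
    rfl
  | succ n ih =>
    rw [iterInt]
    have h : ∀ t : ℝ, iterInt (n + 1) (Fin.tail a) (Fin.tail c) (fun y => F (Fin.cons t y)) =
        ∫ s in a (Fin.last (n + 1))..c (Fin.last (n + 1)),
          iterInt n (Fin.init (Fin.tail a)) (Fin.init (Fin.tail c)) fun y =>
            F (Fin.snoc (α := fun _ => ℝ) (Fin.cons (α := fun _ => ℝ) t y) s) := by
      intro t
      rw [ih]
      · simp only [Fin.tail, Fin.succ_last, Fin.cons_snoc_eq_snoc_cons]
      · exact hF.comp (Continuous.finCons continuous_const continuous_id)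
    simp only [h]
    rw [intervalIntegral_swap]
    · rfl
    · refine continuous_iterInt n continuous_const continuous_const ?_
      exact hF.comp (Continuous.finSnoc
        (Continuous.finCons (continuous_fst.comp continuous_fst) continuous_snd)
        (continuous_snd.comp continuous_fst))

/-- Reversing the order of the variables moves the innermost integral outside, which is Fubini
(`iterInt_succ_last`); the signs come from $t\mapsto-t$. This is the change of variables that
relates $\hat e^+$ to $\hat e^-$. -/
theorem iterInt_neg_rev (n : ℕ) (a c : Fin n → ℝ) {F : (Fin n → ℝ) → ℂ} (hF : Continuous F) :
    iterInt n a c F = iterInt n (fun m => -c m.rev) (fun m => -a m.rev)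
      (fun y => F fun m => -y m.rev) := by
  induction n with
  | zero => exact congrArg F (Subsingleton.elim _ _)
  | succ n ih =>
    rw [iterInt_succ_last n a c hF, iterInt]
    have h : ∀ t : ℝ, iterInt n (Fin.tail fun m => -c m.rev) (Fin.tail fun m => -a m.rev)
        (fun y => F fun m => -(Fin.cons (α := fun _ => ℝ) t y : Fin (n + 1) → ℝ) m.rev) =
        iterInt n (Fin.init a) (Fin.init c) fun y =>
          F (Fin.snoc (α := fun _ => ℝ) y (-t)) := by
      intro t
      rw [ih (Fin.init a) (Fin.init c) (F := fun y => F (Fin.snoc (α := fun _ => ℝ) y (-t)))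
        (hF.comp (Continuous.finSnoc continuous_id continuous_const))]
      have e : ∀ y : Fin n → ℝ,
          (fun m => -(Fin.cons (α := fun _ => ℝ) t y : Fin (n + 1) → ℝ) m.rev) =
          Fin.snoc (α := fun _ => ℝ) (fun m => -y m.rev) (-t) := by
        intro y
        funext m
        induction m using Fin.lastCases with
        | last => simp
        | cast m => simp [Fin.rev_castSucc]
      simp only [e]
      simp only [Fin.init]
      unfold Fin.tail
      simp only [Fin.rev_succ]
    simp only [h, Fin.rev_zero]
    rw [intervalIntegral.integral_comp_neg
      (fun t => iterInt n (Fin.init a) (Fin.init c) fun y => F (Fin.snoc (α := fun _ => ℝ) y t))]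
    simp

/-! ### The operator $b^-$ as a sum over all tuples, and its integral equation -/

/-- The iterated integral of `ê⁻_{μ;i} f` at `(z, p)`, for an arbitrary tuple `i`, as a recursion
on the length of the tuple. -/
noncomputable def chainInt (μ : ℂ) {N : ℕ} (f : Fun N) :
    (n : ℕ) → (Fin n → Fin N) → (Fin N → ℝ) → ℝ → ℂ
  | 0, _, z, p => wave μ p * f z
  | n + 1, i, z, p => ∫ t in z (i 0)..max p (z (i 0)),
      wave μ (p - t) * chainInt μ f n (Fin.tail i) (update z (i 0) t) (z (i 0))

/-- The value of `b⁻_μ f` at `(z, p)`. -/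
noncomputable def lastCreation (γ : ℝ) (μ : ℂ) {N : ℕ} (f : Fun N) (z : Fin N → ℝ) (p : ℝ) : ℂ :=
  ∑ n ∈ Finset.range (N + 1), (γ : ℂ) ^ n * ∑ i : Fin n → Fin N, chainInt μ f n i z p

/-- The upper limit `max p (z (i 0))` makes the integral empty exactly when the chain condition
fails at the first index, so the case distinction causes no jump. The parameter space is arbitrary
because each step of the induction adds the integration variable to it. -/
theorem continuous_chainInt {X : Type*} [TopologicalSpace X] [FirstCountableTopology X]
    [LocallyCompactSpace X] {N : ℕ} (n : ℕ) (i : Fin n → Fin N) {μ : X → ℂ} {f : X → Fun N}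
    {z : X → Fin N → ℝ} {p : X → ℝ} (hμ : Continuous μ)
    (hf : Continuous fun q : X × (Fin N → ℝ) => f q.1 q.2) (hz : Continuous z)
    (hp : Continuous p) :
    Continuous fun x => chainInt (μ x) (f x) n i (z x) (p x) := by
  induction n generalizing X with
  | zero =>
    simp only [chainInt]
    exact (continuous_wave hμ hp).mul (hf.comp (continuous_id.prodMk hz))
  | succ n ih =>
    simp only [chainInt]
    refine continuous_intervalIntegral ?_ (by fun_prop) (by fun_prop)
    refine Continuous.mul (by fun_prop) ?_
    refine ih (X := X × ℝ) (Fin.tail i) (by fun_prop)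
      (hf.comp ((continuous_fst.comp continuous_fst).prodMk continuous_snd)) ?_ (by fun_prop)
    exact (hz.comp continuous_fst).update _ continuous_snd

theorem continuous_lastCreation (γ : ℝ) {X : Type*} [TopologicalSpace X] [FirstCountableTopology X]
    [LocallyCompactSpace X] {N : ℕ} {μ : X → ℂ} {f : X → Fun N}
    {z : X → Fin N → ℝ} {p : X → ℝ} (hμ : Continuous μ)
    (hf : Continuous fun q : X × (Fin N → ℝ) => f q.1 q.2) (hz : Continuous z)
    (hp : Continuous p) :
    Continuous fun x => lastCreation γ (μ x) (f x) (z x) (p x) :=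
  continuous_finsetSum _ fun n _ => continuous_const.mul <|
    continuous_finsetSum _ fun i _ => continuous_chainInt n i hμ hf hz hp

theorem continuous_chainInt_of_const {X : Type*} [TopologicalSpace X] [FirstCountableTopology X]
    [LocallyCompactSpace X] {N : ℕ} (n : ℕ) (i : Fin n → Fin N) (μ : ℂ) {f : Fun N}
    {z : X → Fin N → ℝ} {p : X → ℝ} (hf : Continuous f) (hz : Continuous z)
    (hp : Continuous p) :
    Continuous fun x => chainInt μ f n i (z x) (p x) :=
  continuous_chainInt n i continuous_const (hf.comp continuous_snd) hz hp

theorem chainInt_add (μ : ℂ) {N : ℕ} {f g : Fun N} (hf : Continuous f) (hg : Continuous g)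
    (n : ℕ) (i : Fin n → Fin N) (z : Fin N → ℝ) (p : ℝ) :
    chainInt μ (f + g) n i z p = chainInt μ f n i z p + chainInt μ g n i z p := by
  induction n generalizing z p with
  | zero => simp only [chainInt, Pi.add_apply, mul_add]
  | succ n ih =>
    have h : ∀ h : Fun N, Continuous h → Continuous fun t : ℝ =>
        wave μ (p - t) * chainInt μ h n (Fin.tail i) (update z (i 0) t) (z (i 0)) :=
      fun h hh => Continuous.mul (by fun_prop) (continuous_chainInt_of_const _ _ _ hh
        (continuous_const.update _ continuous_id) continuous_const)
    simp only [chainInt, ih, mul_add]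
    exact intervalIntegral.integral_add ((h f hf).intervalIntegrable ..)
      ((h g hg).intervalIntegrable ..)

theorem chainInt_smul (μ k : ℂ) {N : ℕ} (f : Fun N)
    (n : ℕ) (i : Fin n → Fin N) (z : Fin N → ℝ) (p : ℝ) :
    chainInt μ (k • f) n i z p = k * chainInt μ f n i z p := by
  induction n generalizing z p with
  | zero => simp only [chainInt, Pi.smul_apply, smul_eq_mul]; ring
  | succ n ih =>
    simp only [chainInt, ih, ← intervalIntegral.integral_const_mul]
    refine intervalIntegral.integral_congr fun t _ => ?_
    ring

theorem lastCreation_add (γ : ℝ) (μ : ℂ) {N : ℕ} {f g : Fun N} (hf : Continuous f)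
    (hg : Continuous g) (z : Fin N → ℝ) (p : ℝ) :
    lastCreation γ μ (f + g) z p = lastCreation γ μ f z p + lastCreation γ μ g z p := by
  simp only [lastCreation, chainInt_add μ hf hg, Finset.sum_add_distrib, mul_add]

theorem lastCreation_smul (γ : ℝ) (μ k : ℂ) {N : ℕ} (f : Fun N) (z : Fin N → ℝ) (p : ℝ) :
    lastCreation γ μ (k • f) z p = k * lastCreation γ μ f z p := by
  simp only [lastCreation, chainInt_smul, Finset.mul_sum]
  refine Finset.sum_congr rfl fun n _ => Finset.sum_congr rfl fun i _ => ?_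
  ring

theorem chainInt_permAct (μ : ℂ) {N : ℕ} (f : Fun N) (w : Equiv.Perm (Fin N))
    (n : ℕ) (i : Fin n → Fin N) (z : Fin N → ℝ) (p : ℝ) :
    chainInt μ (permAct w f) n i z p = chainInt μ f n (fun m => w.symm (i m)) (z ∘ w) p := by
  induction n generalizing z p with
  | zero => rfl
  | succ n ih =>
    simp only [chainInt, ih, comp_apply, Equiv.apply_symm_apply]
    refine intervalIntegral.integral_congr fun t _ => ?_
    simp only [update_comp_equiv]
    rfl

/-- A permutation of the first $N$ coordinates only relabels the tuples, and the sum runs over all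
of them. -/
theorem lastCreation_permAct (γ : ℝ) (μ : ℂ) {N : ℕ} (f : Fun N) (w : Equiv.Perm (Fin N))
    (z : Fin N → ℝ) (p : ℝ) :
    lastCreation γ μ (permAct w f) z p = lastCreation γ μ f (z ∘ w) p := by
  simp only [lastCreation, chainInt_permAct]
  refine Finset.sum_congr rfl fun n _ => congrArg _ ?_
  exact Equiv.sum_comp (Equiv.arrowCongr (Equiv.refl (Fin n)) w.symm)
    fun i => chainInt μ f n i (z ∘ w) p

/-- The condition `p > z_{i_1} > ⋯ > z_{i_n}`. -/
def IsChain {N n : ℕ} (i : Fin n → Fin N) (z : Fin N → ℝ) (p : ℝ) : Prop :=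
  ∀ m : Fin n, z (i m) < (Fin.cons p (fun k => z (i k)) : Fin (n + 1) → ℝ) m.castSucc

theorem IsChain.lt {N n : ℕ} {i : Fin n → Fin N} {z : Fin N → ℝ} {p : ℝ}
    (h : IsChain i z p) (m : Fin n) : z (i m) < p := by
  obtain ⟨k, rfl⟩ : ∃ k, n = k + 1 := ⟨n - 1, by have := m.2; omega⟩
  induction m using Fin.induction with
  | zero => simpa [IsChain] using h 0
  | succ m ih =>
    refine lt_trans ?_ ih
    simpa [← Fin.succ_castSucc] using h m.succ

theorem isChain_succ {N n : ℕ} (i : Fin (n + 1) → Fin N) (z : Fin N → ℝ) (p : ℝ) :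
    IsChain i z p ↔ z (i 0) < p ∧ IsChain (Fin.tail i) z (z (i 0)) := by
  unfold IsChain
  rw [Fin.forall_fin_succ]
  refine and_congr (by simp) (forall_congr' fun m => ?_)
  simp only [← Fin.succ_castSucc, Fin.cons_succ]
  have h : (fun k => z (i k)) = Fin.cons (z (i 0)) fun k => z (Fin.tail i k) := by
    funext k
    induction k using Fin.cases <;> rfl
  rw [show z (i m.castSucc) = (fun k => z (i k)) m.castSucc from rfl, h]
  rfl

open Classical in
/-- The closed form of `chainInt` for tuples of distinct elements. -/
theorem chainInt_of_injective (μ : ℂ) {N : ℕ} (f : Fun N) (n : ℕ) (i : Fin n → Fin N)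
    (hi : Injective i) (z : Fin N → ℝ) (p : ℝ) :
    chainInt μ f n i z p = if IsChain i z p then
      wave μ p * iterInt n (fun m => z (i m))
        (fun m => (Fin.cons p (fun k => z (i k)) : Fin (n + 1) → ℝ) m.castSucc)
        (fun y => (∏ m, wave μ (z (i m) - y m)) * f (extend i y z)) else 0 := by
  induction n generalizing z p with
  | zero =>
    rw [if_pos (show IsChain i z p from fun m => m.elim0)]
    simp only [chainInt, iterInt, Finset.univ_eq_empty, Finset.prod_empty, one_mul]
    congr 2
    funext k
    rw [extend_apply' _ _ _ (fun ⟨a, _⟩ => a.elim0)]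
  | succ n ih =>
    have hi' : Injective (Fin.tail i) := hi.comp (Fin.succ_injective n)
    have hne : ∀ m, Fin.tail i m ≠ i 0 := fun m h => (Fin.succ_ne_zero m) (hi h)
    have hc : (fun k => z (i k)) = Fin.cons (z (i 0)) fun k => z (Fin.tail i k) := by
      funext k
      induction k using Fin.cases <;> rfl
    simp only [chainInt, ih _ hi', isChain_succ]
    have hch : ∀ t, IsChain (Fin.tail i) (update z (i 0) t) (z (i 0)) ↔
        IsChain (Fin.tail i) z (z (i 0)) := fun t => by
      simp only [IsChain, update_of_ne (hne _)]
    by_cases h1 : z (i 0) < p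
    · by_cases h2 : IsChain (Fin.tail i) z (z (i 0))
      · rw [if_pos ⟨h1, h2⟩, max_eq_left h1.le, iterInt, ← intervalIntegral.integral_const_mul]
        refine intervalIntegral.integral_congr fun t _ => ?_
        simp only [hch, if_pos h2]
        have e : ∀ y : Fin n → ℝ, extend i (Fin.cons t y : Fin (n + 1) → ℝ) z =
            extend (Fin.tail i) y (update z (i 0) t) := by
          intro y
          funext k
          by_cases hk : ∃ m, i m = k
          · obtain ⟨m, rfl⟩ := hk
            rw [hi.extend_apply]
            induction m using Fin.cases with
            | zero =>
              rw [extend_apply' _ _ _ (fun ⟨a, ha⟩ => hne a ha)]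
              simp
            | succ m =>
              rw [show i m.succ = Fin.tail i m from rfl, hi'.extend_apply, Fin.cons_succ]
          · rw [extend_apply' _ _ _ hk,
              extend_apply' _ _ _ (fun ⟨a, ha⟩ => hk ⟨a.succ, ha⟩),
              update_of_ne (fun h => hk ⟨0, h.symm⟩)]
        simp only [e, Fin.prod_univ_succ, Fin.cons_zero, Fin.cons_succ, mul_assoc,
          update_of_ne (hne _)]
        simp only [iterInt_const_mul]
        -- The recursion restarts the tail at $z_{i_1}$ instead of $p$; regrouping the exponentials
        -- restores the prefactor $e^{i\mu p}$.
        have hw : wave μ (p - t) * wave μ (z (i 0)) = wave μ p * wave μ (z (i 0) - t) := by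
          rw [← wave_add, ← wave_add]
          ring_nf
        rw [← mul_assoc, hw, mul_assoc]
        congr 3
        funext m
        simp only [Fin.tail, ← Fin.succ_castSucc, Fin.cons_succ]
        exact (congrFun hc m.castSucc).symm
      · rw [if_neg (fun h => h2 h.2)]
        simp [hch, h2]
    · rw [if_neg (fun h => h1 h.1), max_eq_right (not_lt.1 h1), intervalIntegral.integral_same]

/-- The entry at $i_1$ is replaced by some $t\ge z_{i_1}$, while all later entries of a chain must
lie below $z_{i_1}$; so a repeated index kills the integral. Hence the sum over distinct indices may
be taken over all tuples, which is what makes the recursion close up. -/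
theorem chainInt_of_not_injective (μ : ℂ) {N : ℕ} (f : Fun N) (n : ℕ) (i : Fin n → Fin N)
    (hi : ¬ Injective i) (z : Fin N → ℝ) (p : ℝ) :
    chainInt μ f n i z p = 0 := by
  induction n generalizing z p with
  | zero => exact absurd (fun a => a.elim0) hi
  | succ n ih =>
    rw [chainInt]
    by_cases hi' : Injective (Fin.tail i)
    · obtain ⟨m, hm⟩ : ∃ m, Fin.tail i m = i 0 := by
        by_contra! h
        refine hi fun a b hab => ?_
        induction a using Fin.cases with
        | zero =>
          induction b using Fin.cases with
          | zero => rfl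
          | succ b => exact absurd hab.symm (h b)
        | succ a =>
          induction b using Fin.cases with
          | zero => exact absurd hab (h a)
          | succ b => exact congrArg _ (hi' hab)
      refine (intervalIntegral.integral_congr (g := fun _ => 0) fun t ht => ?_).trans (by simp)
      rw [Set.uIcc_of_le (le_max_right _ _)] at ht
      simp only
      rw [chainInt_of_injective _ _ _ _ hi', if_neg, mul_zero]
      intro h
      have := h.lt m
      rw [hm, update_self] at this
      exact absurd this (not_lt.2 ht.1)
    · simp [ih _ hi']

theorem sum_chainInt_succ (μ : ℂ) {N : ℕ} (f : Fun N) (n : ℕ) (z : Fin N → ℝ) (p : ℝ) :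
    ∑ i : Fin (n + 1) → Fin N, chainInt μ f (n + 1) i z p =
      ∑ j : Fin N, ∑ i : Fin n → Fin N, ∫ t in z j..max p (z j),
        wave μ (p - t) * chainInt μ f n i (update z j t) (z j) := by
  rw [← (Fin.consEquiv fun _ => Fin N).sum_comp, Fintype.sum_prod_type]
  rfl

/-- The integral equation satisfied by `b⁻_μ f`. -/
theorem lastCreation_eq (γ : ℝ) (μ : ℂ) {N : ℕ} {f : Fun N} (hf : Continuous f)
    (z : Fin N → ℝ) (p : ℝ) :
    lastCreation γ μ f z p = wave μ p * f z + γ * ∑ j, ∫ t in z j..max p (z j),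
      wave μ (p - t) * lastCreation γ μ f (update z j t) (z j) := by
  have hint : ∀ (j : Fin N) (n : ℕ) (i : Fin n → Fin N), IntervalIntegrable
      (fun t => wave μ (p - t) * chainInt μ f n i (update z j t) (z j)) MeasureTheory.volume
      (z j) (max p (z j)) := fun j n i =>
    (Continuous.mul (by fun_prop) (continuous_chainInt_of_const n i μ hf
      (continuous_const.update _ continuous_id) continuous_const)).intervalIntegrable ..
  have hR : ∀ j, ∫ t in z j..max p (z j),
      wave μ (p - t) * lastCreation γ μ f (update z j t) (z j) =
      ∑ n ∈ Finset.range (N + 1), (γ : ℂ) ^ n * ∑ i : Fin n → Fin N, ∫ t in z j..max p (z j),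
        wave μ (p - t) * chainInt μ f n i (update z j t) (z j) := by
    intro j
    simp only [lastCreation, Finset.mul_sum]
    rw [intervalIntegral.integral_finsetSum]
    · refine Finset.sum_congr rfl fun n _ => ?_
      rw [intervalIntegral.integral_finsetSum]
      · refine Finset.sum_congr rfl fun i _ => ?_
        rw [← intervalIntegral.integral_const_mul]
        refine intervalIntegral.integral_congr fun t _ => ?_
        ring
      · intro i _
        simpa only [mul_left_comm] using (hint j n i).const_mul ((γ : ℂ) ^ n)
    · intro n _
      have := IntervalIntegrable.sum Finset.univ fun i (_ : i ∈ Finset.univ) =>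
        (hint j n i).const_mul ((γ : ℂ) ^ n)
      simpa only [mul_left_comm, Finset.sum_fn] using this
  -- No tuple of length $N+1$ is injective, so one more length can be added to the sum; splitting
  -- off the first index then leaves exactly the lengths $0,\dots,N$.
  have htop : ∑ i : Fin (N + 1) → Fin N, chainInt μ f (N + 1) i z p = 0 := by
    refine Finset.sum_eq_zero fun i _ => chainInt_of_not_injective _ _ _ _ (fun h => ?_) _ _
    simpa using Fintype.card_le_of_injective i h
  have hL : lastCreation γ μ f z p =
      ∑ n ∈ Finset.range (N + 2), (γ : ℂ) ^ n * ∑ i : Fin n → Fin N, chainInt μ f n i z p := by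
    rw [Finset.sum_range_succ _ (N + 1), htop, mul_zero, add_zero, lastCreation]
  rw [hL, Finset.sum_range_succ' _ (N + 1), add_comm]
  congr 1
  · simp [chainInt]
  · simp only [hR, sum_chainInt_succ]
    rw [Finset.sum_comm, Finset.mul_sum]
    refine Finset.sum_congr rfl fun n _ => ?_
    rw [pow_succ', mul_assoc, Finset.mul_sum]

/-- All integrals are empty. This supplies the initial values for the differential equations and the
plane wave on the fundamental alcove. -/
theorem lastCreation_of_le (γ : ℝ) (μ : ℂ) {N : ℕ} {f : Fun N} (hf : Continuous f)
    {z : Fin N → ℝ} {p : ℝ} (h : ∀ j, p ≤ z j) :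
    lastCreation γ μ f z p = wave μ p * f z := by
  rw [lastCreation_eq γ μ hf, Finset.sum_eq_zero, mul_zero, add_zero]
  intro j _
  rw [max_eq_right (h j), intervalIntegral.integral_same]

theorem eMinus_eq_chainInt (μ : ℂ) {N n : ℕ} (i : Fin n ↪ Fin N) (f : Fun N)
    (x : Fin (N + 1) → ℝ) :
    eMinus μ i f x = chainInt μ f n i (Fin.init x) (x (Fin.last N)) := by
  rw [chainInt_of_injective μ f n i i.injective]
  have h : ∀ k, x (minusChain i k) =
      (Fin.cons (x (Fin.last N)) (fun k => Fin.init x (i k)) : Fin (n + 1) → ℝ) k := by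
    intro k
    induction k using Fin.cases <;> rfl
  simp only [eMinus, h, Fin.cons_succ]
  classical exact if_congr Iff.rfl rfl rfl

theorem creation_minus_apply (γ : ℝ) (μ : ℂ) {N : ℕ} (f : Fun N) (x : Fin (N + 1) → ℝ) :
    creation γ .minus μ f x = lastCreation γ μ f (Fin.init x) (x (Fin.last N)) := by
  simp only [creation, lastCreation, Finset.sum_apply, Pi.smul_apply, smul_eq_mul, elemCreation,
    eMinus_eq_chainInt]
  refine Finset.sum_congr rfl fun n _ => congrArg _ ?_
  classical
  rw [← Finset.sum_filter_of_ne (p := Injective)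
    fun i _ h => by_contra fun h' => h (chainInt_of_not_injective μ f n i h' _ _)]
  rw [← Finset.sum_subtype_eq_sum_filter, Finset.subtype_univ]
  exact Equiv.sum_comp (Equiv.subtypeInjectiveEquivEmbedding (Fin n) (Fin N)).symm
    fun i : {i : Fin n → Fin N // Injective i} => chainInt μ f n i (Fin.init x) (x (Fin.last N))

/-- The integral equation of `lastCreation`, normalized and as a difference of two values. -/
theorem lastCreation_sub (γ : ℝ) (μ : ℂ) {N : ℕ} {f : Fun N} (hf : Continuous f)
    (z : Fin N → ℝ) (r p : ℝ) :
    wave μ (-p) * lastCreation γ μ f z p - wave μ (-r) * lastCreation γ μ f z r =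
      γ * ∑ j, ∫ t in max r (z j)..max p (z j),
        wave μ (-t) * lastCreation γ μ f (update z j t) (z j) := by
  have h : ∀ x, wave μ (-x) * lastCreation γ μ f z x = f z + γ * ∑ j, ∫ t in z j..max x (z j),
      wave μ (-t) * lastCreation γ μ f (update z j t) (z j) := by
    intro x
    have hw : ∀ t, wave μ (x - t) = wave μ x * wave μ (-t) := fun t => wave_sub μ x t
    rw [lastCreation_eq γ μ hf]
    simp only [hw, mul_assoc, intervalIntegral.integral_const_mul, ← Finset.mul_sum]
    linear_combination (f z + γ * ∑ j, ∫ t in z j..max x (z j),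
      wave μ (-t) * lastCreation γ μ f (update z j t) (z j)) * wave_neg_mul_self μ x
  have hi : ∀ j u v, IntervalIntegrable
      (fun t => wave μ (-t) * lastCreation γ μ f (update z j t) (z j))
      MeasureTheory.volume u v := fun j u v =>
    (Continuous.mul (by fun_prop) (continuous_lastCreation γ continuous_const
      (hf.comp continuous_snd) (continuous_const.update _ continuous_id)
      continuous_const)).intervalIntegrable ..
  rw [h, h, add_sub_add_left_eq_sub, ← mul_sub, ← Finset.sum_sub_distrib]
  refine congrArg _ (Finset.sum_congr rfl fun j _ => ?_)
  exact intervalIntegral.integral_interval_sub_left (hi ..) (hi ..)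

/-! ### Integral equations for $b^-_\mu b^-_\nu f$ -/

/-- The value of `b⁻_μ b⁻_ν f` at `(z, p, q)`. -/
noncomputable def twoCreation (γ : ℝ) (μ ν : ℂ) {N : ℕ} (f : Fun N)
    (z : Fin N → ℝ) (p q : ℝ) : ℂ :=
  lastCreation γ μ (fun x : Fin (N + 1) → ℝ => lastCreation γ ν f (Fin.init x) (x (Fin.last N)))
    (Fin.snoc (α := fun _ => ℝ) z p) q

section

variable (γ : ℝ) (μ ν : ℂ) {N : ℕ} {f : Fun N} (hf : Continuous f)
include hf

theorem continuous_lastCreation_init :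
    Continuous fun x : Fin (N + 1) → ℝ => lastCreation γ ν f (Fin.init x) (x (Fin.last N)) :=
  continuous_lastCreation γ continuous_const (hf.comp continuous_snd)
    (by unfold Fin.init; fun_prop) (by fun_prop)

theorem continuous_twoCreation {X : Type*} [TopologicalSpace X] [FirstCountableTopology X]
    [LocallyCompactSpace X] {z : X → Fin N → ℝ} {p q : X → ℝ} (hz : Continuous z)
    (hp : Continuous p) (hq : Continuous q) :
    Continuous fun x => twoCreation γ μ ν f (z x) (p x) (q x) :=
  continuous_lastCreation γ continuous_const
    ((continuous_lastCreation_init γ ν hf).comp continuous_snd) (hz.finSnoc hp) hq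

/-- This is the integral equation in $N+1$ variables; the separate last term comes from the
coordinate $p$, and it puts the old value of $p$ in the last place. -/
theorem twoCreation_eq (z : Fin N → ℝ) (p q : ℝ) :
    twoCreation γ μ ν f z p q = wave μ q * lastCreation γ ν f z p +
      γ * ((∑ j, ∫ t in z j..max q (z j),
        wave μ (q - t) * twoCreation γ μ ν f (update z j t) p (z j)) +
        ∫ t in p..max q p, wave μ (q - t) * twoCreation γ μ ν f z t p) := by
  rw [twoCreation, lastCreation_eq γ μ (continuous_lastCreation_init γ ν hf),
    Fin.sum_univ_castSucc]
  simp only [Fin.init_snoc, Fin.snoc_last, Fin.snoc_castSucc, ← Fin.snoc_update,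
    Fin.update_snoc_last, twoCreation]

theorem twoCreation_sub_right (z : Fin N → ℝ) (p r q : ℝ) :
    wave μ (-q) * twoCreation γ μ ν f z p q - wave μ (-r) * twoCreation γ μ ν f z p r =
      γ * ((∑ j, ∫ t in max r (z j)..max q (z j),
        wave μ (-t) * twoCreation γ μ ν f (update z j t) p (z j)) +
        ∫ t in max r p..max q p, wave μ (-t) * twoCreation γ μ ν f z t p) := by
  simp only [twoCreation]
  rw [lastCreation_sub γ μ (continuous_lastCreation_init γ ν hf), Fin.sum_univ_castSucc]
  simp only [Fin.snoc_last, Fin.snoc_castSucc, ← Fin.snoc_update, Fin.update_snoc_last]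

theorem twoCreation_of_le {z : Fin N → ℝ} {q : ℝ} (h : ∀ j, q ≤ z j) :
    twoCreation γ μ ν f z q q = wave μ q * (wave ν q * f z) := by
  rw [twoCreation, lastCreation_of_le γ μ (continuous_lastCreation_init γ ν hf)]
  · rw [Fin.init_snoc, Fin.snoc_last, lastCreation_of_le γ ν hf h]
  · intro j
    induction j using Fin.lastCases with
    | last => rw [Fin.snoc_last]
    | cast j => rw [Fin.snoc_castSucc]; exact h j

end

/-- The number of coordinates of `z` below `a`. -/
noncomputable def below {N : ℕ} (z : Fin N → ℝ) (a : ℝ) : ℕ := by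
  classical exact (Finset.univ.filter fun j => z j < a).card

/-- The index $k$ leaves the set and none enters. This is the descent step of the inductions for
$b^-_\mu b^-_\nu f$. -/
theorem below_update_lt {N : ℕ} {z : Fin N → ℝ} {k : Fin N} {t a b : ℝ} (hk : z k < a)
    (ht : b ≤ t) (hb : b ≤ a) : below (update z k t) b < below z a := by
  classical
  refine Finset.card_lt_card ((Finset.ssubset_iff_of_subset fun j hj => ?_).2 ⟨k, ?_, ?_⟩)
  · simp only [Finset.mem_filter, Finset.mem_univ, true_and] at hj ⊢
    by_cases h : j = k
    · exact h ▸ hk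
    · rw [update_of_ne h] at hj
      exact hj.trans_le hb
  · simpa using hk
  · simpa using ht

/-- With $s\ge q$ in position $k$, the $k$-th integral is empty, while the term of the last but one
variable, now $z_k$, runs over the interval that the $k$-th integral has for $z$ itself. It fills
the gap in the sum. -/
theorem twoCreation_update_eq (γ : ℝ) (μ ν : ℂ) {N : ℕ} {f : Fun N} (hf : Continuous f)
    (z : Fin N → ℝ) (k : Fin N) {s q : ℝ} (hs : q ≤ s) :
    twoCreation γ μ ν f (update z k s) (z k) q =
      wave μ q * lastCreation γ ν f (update z k s) (z k) +
      γ * ∑ j, ∫ t in z j..max q (z j), wave μ (q - t) *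
        if k = j then twoCreation γ μ ν f (update z k s) t (z k)
        else twoCreation γ μ ν f (update (update z k s) j t) (z k) (z j) := by
  rw [twoCreation_eq γ μ ν hf]
  congr 2
  rw [← Finset.add_sum_erase _ _ (Finset.mem_univ k),
    ← Finset.add_sum_erase _ _ (Finset.mem_univ k)]
  rw [update_self, max_eq_right hs, intervalIntegral.integral_same, zero_add, add_comm]
  simp only [if_true]
  congr 1
  refine Finset.sum_congr rfl fun j hj => ?_
  have hjk : j ≠ k := Finset.ne_of_mem_erase hj
  simp only [update_of_ne hjk, if_neg hjk.symm]

/-- The differential equation of `b⁻_μ b⁻_ν f` in its last but one variable, in integrated form. -/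
theorem twoCreation_sub_left (γ : ℝ) (μ ν : ℂ) {N : ℕ} {f : Fun N} (hf : Continuous f)
    (z : Fin N → ℝ) {p r q : ℝ} (hqr : q ≤ r) (hrp : r ≤ p) :
    wave ν (-p) * twoCreation γ μ ν f z p q - wave ν (-r) * twoCreation γ μ ν f z r q =
      γ * ∑ k, ∫ s in max r (z k)..max p (z k),
        wave ν (-s) * twoCreation γ μ ν f (update z k s) (z k) q := by
  induction hn : below z q using Nat.strong_induction_on generalizing z q with
  | _ n ih =>
  set G := twoCreation γ μ ν f with hG
  -- Unfolding both sides by the integral equation in $q$ produces double integrals; `T` is their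
  -- common integrand. On the left (`hL`) it arises from the induction hypothesis and Fubini, on the
  -- right (`hR`) from `twoCreation_update_eq`.
  let T : Fin N → Fin N → ℝ → ℝ → ℂ := fun j k s t => wave μ (q - t) * (wave ν (-s) *
    if k = j then G (update z k s) t (z k) else G (update (update z k s) j t) (z k) (z j))
  have hT : ∀ j k, Continuous fun x : ℝ × ℝ => T j k x.1 x.2 := by
    intro j k
    refine Continuous.mul (by fun_prop) (Continuous.mul (by fun_prop) ?_)
    split_ifs
    · exact continuous_twoCreation γ μ ν hf (continuous_const.update _ continuous_fst)
        continuous_snd continuous_const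
    · have hu₀ : Continuous fun x : ℝ × ℝ => update z k x.1 :=
        continuous_const.update k continuous_fst
      have hu : Continuous fun x : ℝ × ℝ => update (update z k x.1) j x.2 :=
        hu₀.update j continuous_snd
      exact continuous_twoCreation γ μ ν hf hu continuous_const continuous_const
  have hTi : ∀ j k, Continuous fun s => ∫ t in z j..max q (z j), T j k s t := fun j k =>
    continuous_intervalIntegral (hT j k) continuous_const continuous_const
  have hg : ∀ k, Continuous fun s => wave ν (-s) * lastCreation γ ν f (update z k s) (z k) :=
    fun k => Continuous.mul (by fun_prop) (continuous_lastCreation γ continuous_const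
      (hf.comp continuous_snd) (continuous_const.update _ continuous_id) continuous_const)
  have hL : ∀ j, (∫ t in z j..max q (z j), wave μ (q - t) *
      (wave ν (-p) * G (update z j t) p (z j) - wave ν (-r) * G (update z j t) r (z j))) =
      γ * ∑ k, ∫ s in max r (z k)..max p (z k), ∫ t in z j..max q (z j), T j k s t := by
    intro j
    rcases lt_or_ge (z j) q with hj | hj
    · simp only [intervalIntegral_swap (hT j _)]
      rw [← intervalIntegral.integral_finsetSum, ← intervalIntegral.integral_const_mul]
      · refine intervalIntegral.integral_congr fun t ht => ?_
        rw [max_eq_left hj.le, Set.uIcc_of_le hj.le] at ht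
        rw [ih _ (hn ▸ below_update_lt hj ht.1 hj.le) (update z j t) (hj.le.trans hqr) rfl,
          mul_left_comm, Finset.mul_sum]
        refine congrArg _ (Finset.sum_congr rfl fun k _ => ?_)
        rw [← intervalIntegral.integral_const_mul]
        by_cases hkj : k = j
        · subst hkj
          simp only [T, if_true, update_self, update_idem]
          -- As $z_j<q$ and $t\le q\le r\le p$, replacing $z_j$ by $t$ does not affect the limits of
          -- integration.
          rw [max_eq_left (ht.2.trans hqr), max_eq_left (ht.2.trans (hqr.trans hrp)),
            max_eq_left (hj.le.trans hqr), max_eq_left (hj.le.trans (hqr.trans hrp))]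
        · simp only [T, if_neg hkj, update_of_ne hkj]
          simp only [update_comm (Ne.symm hkj)]
      · intro k _
        exact (continuous_intervalIntegral (F := fun t s => T j k s t) ((hT j k).comp continuous_swap) continuous_const
          continuous_const).intervalIntegrable ..
    · simp [max_eq_right hj]
  have hR : ∀ k, (∫ s in max r (z k)..max p (z k), wave ν (-s) * G (update z k s) (z k) q) =
      wave μ q * (∫ s in max r (z k)..max p (z k),
        wave ν (-s) * lastCreation γ ν f (update z k s) (z k)) +
      γ * ∑ j, ∫ s in max r (z k)..max p (z k), ∫ t in z j..max q (z j), T j k s t := by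
    intro k
    rw [← intervalIntegral.integral_const_mul, ← intervalIntegral.integral_finsetSum,
      ← intervalIntegral.integral_const_mul, ← intervalIntegral.integral_add]
    · refine intervalIntegral.integral_congr fun s hs => ?_
      rw [Set.uIcc_of_le (max_le_max_right _ hrp)] at hs
      rw [hG, twoCreation_update_eq γ μ ν hf z k (hqr.trans ((le_max_left _ _).trans hs.1)),
        mul_add, mul_left_comm (wave ν (-s)), mul_left_comm (wave ν (-s)), Finset.mul_sum]
      refine congrArg _ (congrArg _ (Finset.sum_congr rfl fun j _ => ?_))
      rw [← intervalIntegral.integral_const_mul]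
      refine intervalIntegral.integral_congr fun t _ => ?_
      simp only [T, hG]
      ring
    · exact (continuous_const.mul (hg k)).intervalIntegrable ..
    · exact (continuous_const.mul
        (continuous_finsetSum _ fun j _ => hTi j k)).intervalIntegrable ..
    · exact fun j _ => (hTi j k).intervalIntegrable ..
  have hI : ∀ j x, IntervalIntegrable (fun t => wave μ (q - t) *
      (wave ν (-x) * G (update z j t) x (z j))) MeasureTheory.volume (z j) (max q (z j)) :=
    fun j x => (Continuous.mul (by fun_prop) (continuous_const.mul
      (continuous_twoCreation γ μ ν hf (continuous_const.update _ continuous_id)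
        continuous_const continuous_const))).intervalIntegrable ..
  have hE : ∀ x, q ≤ x → wave ν (-x) * G z x q =
      wave μ q * (wave ν (-x) * lastCreation γ ν f z x) + γ * ∑ j, ∫ t in z j..max q (z j),
        wave μ (q - t) * (wave ν (-x) * G (update z j t) x (z j)) := by
    intro x hx
    rw [hG, twoCreation_eq γ μ ν hf, max_eq_right hx, intervalIntegral.integral_same, add_zero,
      mul_add, mul_left_comm, mul_left_comm _ (γ : ℂ), Finset.mul_sum]
    refine congrArg _ (congrArg _ (Finset.sum_congr rfl fun j _ => ?_))
    rw [← intervalIntegral.integral_const_mul]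
    refine intervalIntegral.integral_congr fun t _ => ?_
    ring
  have hS : wave ν (-p) * G z p q - wave ν (-r) * G z r q =
      wave μ q * (wave ν (-p) * lastCreation γ ν f z p - wave ν (-r) * lastCreation γ ν f z r) +
      γ * ∑ j, ∫ t in z j..max q (z j), wave μ (q - t) *
      (wave ν (-p) * G (update z j t) p (z j) - wave ν (-r) * G (update z j t) r (z j)) := by
    rw [hE p (hqr.trans hrp), hE r hqr]
    simp only [mul_sub, intervalIntegral.integral_sub (hI _ p) (hI _ r), Finset.sum_sub_distrib]
    ring
  rw [hS, lastCreation_sub γ ν hf]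
  simp only [hL, hR]
  rw [Finset.sum_add_distrib, ← Finset.mul_sum, ← Finset.mul_sum, ← Finset.mul_sum,
    Finset.sum_comm]
  ring

/-! ### One-sided derivatives and the exchange relation for $b^-_\mu b^-_\nu$ -/

/-- Right derivatives avoid the kink at $x=a$. The interval is degenerate at $x=q$, so the
dependence of the integrand on $x$ does not contribute. -/
theorem hasDerivWithinAt_intervalIntegral_max {Φ : ℝ → ℝ → ℂ}
    (hΦ : Continuous fun x : ℝ × ℝ => Φ x.1 x.2) (a q : ℝ) :
    HasDerivWithinAt (fun x => ∫ s in max q a..max x a, Φ x s)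
      (if a ≤ q then Φ q q else 0) (Set.Ici q) q := by
  split_ifs with h
  · rw [hasDerivWithinAt_iff_isLittleO, Asymptotics.isLittleO_iff]
    intro c hc
    obtain ⟨δ, hδ, hd⟩ := Metric.continuousAt_iff.1 (hΦ.continuousAt (x := (q, q))) c hc
    filter_upwards [inter_mem_nhdsWithin (Set.Ici q) (Metric.ball_mem_nhds q hδ)] with x hx
    have hqx : q ≤ x := hx.1
    have hi : IntervalIntegrable (Φ x) MeasureTheory.volume q x :=
      (hΦ.comp (Continuous.prodMk_right x)).intervalIntegrable ..
    rw [max_eq_left h, max_eq_left (h.trans hqx), intervalIntegral.integral_same, sub_zero,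
      ← intervalIntegral.integral_const, ← intervalIntegral.integral_sub hi (by simp),
      Real.norm_eq_abs]
    refine intervalIntegral.norm_integral_le_of_norm_le_const fun s hs => ?_
    rw [Set.uIoc_of_le hqx] at hs
    have h2 : dist x q < δ := hx.2
    have h3 : dist s q < δ := by
      rw [Real.dist_eq, abs_of_nonneg (by linarith [hs.1])] at *
      linarith [hs.2]
    rw [← dist_eq_norm]
    exact (hd (x := (x, s)) (by simpa [Prod.dist_eq] using ⟨h2, h3⟩)).le
  · have h' : q < a := not_le.1 h
    refine (hasDerivWithinAt_const q (Set.Ici q) (0 : ℂ)).congr_of_eventuallyEq ?_ (by simp)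
    filter_upwards [mem_nhdsWithin_of_mem_nhds (Iio_mem_nhds h')] with x hx
    rw [max_eq_right h'.le, max_eq_right (Set.mem_Iio.1 hx).le, intervalIntegral.integral_same]

section

variable (γ : ℝ) (μ ν : ℂ) {N : ℕ} {f : Fun N} (hf : Continuous f)
include hf

/-- The last term, with $p$ and $q$ interchanged, comes from chains starting at $p$. It has no
counterpart in the derivative in the other variable and is the source of the right-hand side of the
exchange relation. -/
theorem hasDerivWithinAt_twoCreation_right (z : Fin N → ℝ) {p q : ℝ} (h : p ≤ q) :
    HasDerivWithinAt (fun x => wave μ (-x) * twoCreation γ μ ν f z p x)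
      (γ * ((∑ k, if z k ≤ q then wave μ (-q) * twoCreation γ μ ν f (update z k q) p (z k) else 0) +
        wave μ (-q) * twoCreation γ μ ν f z q p)) (Set.Ici q) q := by
  have h1 : ∀ k, Continuous fun x : ℝ × ℝ =>
      wave μ (-x.2) * twoCreation γ μ ν f (update z k x.2) p (z k) := fun k =>
    Continuous.mul (by fun_prop) (continuous_twoCreation γ μ ν hf
      (continuous_const.update _ continuous_snd) continuous_const continuous_const)
  have h2 : Continuous fun x : ℝ × ℝ => wave μ (-x.2) * twoCreation γ μ ν f z x.2 p :=
    Continuous.mul (by fun_prop) (continuous_twoCreation γ μ ν hf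
      continuous_const continuous_snd continuous_const)
  have h3 := hasDerivWithinAt_intervalIntegral_max
    (Φ := fun _ s => wave μ (-s) * twoCreation γ μ ν f z s p) h2 p q
  rw [if_pos h] at h3
  have h4 := (((HasDerivWithinAt.fun_sum (u := Finset.univ) fun k _ =>
    hasDerivWithinAt_intervalIntegral_max
      (Φ := fun _ s => wave μ (-s) * twoCreation γ μ ν f (update z k s) p (z k))
      (h1 k) (z k) q).fun_add h3).const_mul (γ : ℂ)).const_add
    (wave μ (-q) * twoCreation γ μ ν f z p q)
  refine h4.congr_of_mem (fun x _ => ?_) Set.self_mem_Ici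
  rw [← sub_eq_iff_eq_add', twoCreation_sub_right γ μ ν hf]

theorem hasDerivWithinAt_twoCreation_left (z : Fin N → ℝ) {p q : ℝ} (h : p ≤ q) :
    HasDerivWithinAt (fun x => wave ν (-x) * twoCreation γ μ ν f z x p)
      (γ * ∑ k, if z k ≤ q then wave ν (-q) * twoCreation γ μ ν f (update z k q) (z k) p else 0)
      (Set.Ici q) q := by
  have h1 : ∀ k, Continuous fun x : ℝ × ℝ =>
      wave ν (-x.2) * twoCreation γ μ ν f (update z k x.2) (z k) p := fun k =>
    Continuous.mul (by fun_prop) (continuous_twoCreation γ μ ν hf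
      (continuous_const.update _ continuous_snd) continuous_const continuous_const)
  have h4 := ((HasDerivWithinAt.fun_sum (u := Finset.univ) fun k _ =>
    hasDerivWithinAt_intervalIntegral_max
      (Φ := fun _ s => wave ν (-s) * twoCreation γ μ ν f (update z k s) (z k) p)
      (h1 k) (z k) q).const_mul (γ : ℂ)).const_add
    (wave ν (-q) * twoCreation γ μ ν f z q p)
  refine h4.congr_of_mem (fun x hx => ?_) Set.self_mem_Ici
  rw [← sub_eq_iff_eq_add', twoCreation_sub_left γ μ ν hf z h hx]

theorem hasDerivWithinAt_twoCreation_diag (z : Fin N → ℝ) (q : ℝ) :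
    HasDerivWithinAt (fun x => wave μ (-x) * (wave ν (-x) * twoCreation γ μ ν f z x x))
      (γ * ∑ k, if z k ≤ q then
        wave μ (-q) * (wave ν (-q) * twoCreation γ μ ν f (update z k q) (z k) q) +
        wave ν (-q) * (wave μ (-q) * twoCreation γ μ ν f (update z k q) q (z k)) else 0)
      (Set.Ici q) q := by
  have h1 : ∀ k, Continuous fun x : ℝ × ℝ =>
      wave μ (-q) * (wave ν (-x.2) * twoCreation γ μ ν f (update z k x.2) (z k) q) := fun k =>
    continuous_const.mul (Continuous.mul (by fun_prop) (continuous_twoCreation γ μ ν hf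
      (continuous_const.update _ continuous_snd) continuous_const continuous_const))
  have h2 : ∀ k, Continuous fun x : ℝ × ℝ =>
      wave ν (-x.1) * (wave μ (-x.2) * twoCreation γ μ ν f (update z k x.2) x.1 (z k)) := fun k =>
    Continuous.mul (by fun_prop) (Continuous.mul (by fun_prop) (continuous_twoCreation γ μ ν hf
      (continuous_const.update _ continuous_snd) continuous_fst continuous_const))
  have h4 := ((HasDerivWithinAt.fun_sum (u := Finset.univ) fun k _ =>
    hasDerivWithinAt_intervalIntegral_max
      (Φ := fun x s => wave μ (-q) * (wave ν (-s) * twoCreation γ μ ν f (update z k s) (z k) q) +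
        wave ν (-x) * (wave μ (-s) * twoCreation γ μ ν f (update z k s) x (z k)))
      ((h1 k).add (h2 k)) (z k) q).const_mul (γ : ℂ)).const_add (wave μ (-q) * (wave ν (-q) * twoCreation γ μ ν f z q q))
  refine h4.congr_of_mem (fun x hx => ?_) Set.self_mem_Ici
  have hi : ∀ k (u v : ℝ), IntervalIntegrable (fun s =>
      wave μ (-q) * (wave ν (-s) * twoCreation γ μ ν f (update z k s) (z k) q))
      MeasureTheory.volume u v := fun k u v =>
    ((h1 k).comp (Continuous.prodMk_right x)).intervalIntegrable ..
  have hi' : ∀ k (u v : ℝ), IntervalIntegrable (fun s =>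
      wave ν (-x) * (wave μ (-s) * twoCreation γ μ ν f (update z k s) x (z k)))
      MeasureTheory.volume u v := fun k u v =>
    ((h2 k).comp (Continuous.prodMk_right x)).intervalIntegrable ..
  -- The diagonal increment is taken in two steps: first the last but one variable moves from $q$ to
  -- $x$, then the last one. In the second step the integral from the last but one variable is
  -- empty.
  have e1 := twoCreation_sub_left γ μ ν hf z le_rfl (Set.mem_Ici.1 hx)
  have e2 := twoCreation_sub_right γ μ ν hf z x q x
  rw [max_self, max_eq_right (Set.mem_Ici.1 hx), intervalIntegral.integral_same, add_zero] at e2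
  simp only [intervalIntegral.integral_add (hi _ _ _) (hi' _ _ _), Finset.sum_add_distrib,
    intervalIntegral.integral_const_mul, ← Finset.mul_sum]
  linear_combination wave μ (-q) * e1 + wave ν (-x) * e2

/-- `[b⁻_μ, b⁻_ν] f` vanishes where its last two variables agree, if the exchange relation is known
at all points with fewer coordinates below. -/
theorem twoCreation_diag_comm (z : Fin N → ℝ) (q : ℝ)
    (ih : ∀ (z' : Fin N → ℝ) (p' q' : ℝ), q' ≤ p' → below z' p' < below z q →
      twoCreation γ μ ν f z' p' q' + twoCreation γ μ ν f z' q' p' =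
        twoCreation γ ν μ f z' p' q' + twoCreation γ ν μ f z' q' p') :
    twoCreation γ μ ν f z q q = twoCreation γ ν μ f z q q := by
  -- Below all coordinates, $b^-_\mu b^-_\nu f$ is symmetric in $\mu,\nu$ on the diagonal; this is
  -- the starting point. From there on, the derivative involves only symmetrized values at points
  -- with fewer coordinates below.
  obtain ⟨r, hr⟩ : ∃ r, r ≤ q ∧ ∀ j, r ≤ z j := by
    obtain ⟨b, hb⟩ := (Set.finite_range z).bddBelow
    exact ⟨min q b, min_le_left _ _, fun j => (min_le_right _ _).trans (hb ⟨j, rfl⟩)⟩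
  let h : ℝ → ℂ := fun x => wave μ (-x) * (wave ν (-x) * twoCreation γ μ ν f z x x) -
    wave ν (-x) * (wave μ (-x) * twoCreation γ ν μ f z x x)
  have hc : Continuous h := by
    have h1 := continuous_twoCreation γ μ ν hf (X := ℝ) (z := fun _ => z) continuous_const
      continuous_id continuous_id
    have h2 := continuous_twoCreation γ ν μ hf (X := ℝ) (z := fun _ => z) continuous_const
      continuous_id continuous_id
    exact (Continuous.mul (by fun_prop) (Continuous.mul (by fun_prop) h1)).sub
      (Continuous.mul (by fun_prop) (Continuous.mul (by fun_prop) h2))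
  have hd : ∀ x ∈ Set.Ico r q, HasDerivWithinAt h 0 (Set.Ici x) x := by
    intro x hx
    refine ((hasDerivWithinAt_twoCreation_diag γ μ ν hf z x).fun_sub
      (hasDerivWithinAt_twoCreation_diag γ ν μ hf z x)).congr_deriv ?_
    rw [← mul_sub, ← Finset.sum_sub_distrib, Finset.sum_eq_zero, mul_zero]
    intro k _
    split_ifs with hk
    · have := ih (update z k x) x (z k) hk
        (below_update_lt (hk.trans_lt hx.2) le_rfl hx.2.le)
      linear_combination wave μ (-x) * wave ν (-x) * this
    · exact sub_zero 0
  have hq := constant_of_has_deriv_right_zero hc.continuousOn hd q ⟨hr.1, le_rfl⟩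
  have hr0 : h r = 0 := by
    simp only [h, twoCreation_of_le γ _ _ hf hr.2]
    ring
  rw [hr0] at hq
  have hq' : wave μ (-q) * wave ν (-q) * (twoCreation γ μ ν f z q q - twoCreation γ ν μ f z q q)
      = 0 := by
    rw [← hq]
    ring
  refine sub_eq_zero.1 ((mul_eq_zero.1 hq').resolve_left (mul_ne_zero ?_ ?_)) <;>
    exact Complex.exp_ne_zero _

/-- The exchange relation of `b⁻_μ` and `b⁻_ν` at points with ordered last coordinates, if it is
known at all points with fewer coordinates below. -/
theorem twoCreation_exchange_of_le (hμν : μ ≠ ν) (z : Fin N → ℝ) {p q : ℝ} (hqp : q ≤ p)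
    (ih : ∀ (z' : Fin N → ℝ) (p' q' : ℝ), below z' (max p' q') < below z p →
      (μ - ν) * (twoCreation γ μ ν f z' q' p' - twoCreation γ ν μ f z' p' q') =
        Complex.I * γ * (twoCreation γ μ ν f z' p' q' - twoCreation γ ν μ f z' p' q') ∧
      (ν - μ) * (twoCreation γ ν μ f z' q' p' - twoCreation γ μ ν f z' p' q') =
        Complex.I * γ * (twoCreation γ ν μ f z' p' q' - twoCreation γ μ ν f z' p' q')) :
    (μ - ν) * (twoCreation γ μ ν f z q p - twoCreation γ ν μ f z p q) =
      Complex.I * γ * (twoCreation γ μ ν f z p q - twoCreation γ ν μ f z p q) := by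
  have hd0 : μ - ν ≠ 0 := sub_ne_zero.2 hμν
  have hbelow : below z q ≤ below z p := by
    classical
    exact Finset.card_le_card fun j hj => by
      simp only [Finset.mem_filter, Finset.mem_univ, true_and] at hj ⊢
      exact hj.trans_le hqp
  -- In the sum of the two exchange relations the right-hand sides combine with the left to give
  -- equality of the values symmetrized in the last two variables.
  have hdiag := twoCreation_diag_comm γ μ ν hf z q fun z' p' q' hq' hlt => by
    obtain ⟨h1, h2⟩ := ih z' p' q' (by rw [max_eq_left hq']; exact hlt.trans_le hbelow)
    refine mul_left_cancel₀ hd0 ?_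
    linear_combination h1 + h2
  -- The defect of the relation, times $e^{-i\mu x}$. The factor `wave (ν - μ) x` converts the
  -- normalization $e^{-i\nu x}$ suited to the last but one variable of $b^-_\mu b^-_\nu f$; its
  -- derivative cancels the extra term in `hasDerivWithinAt_twoCreation_right`. The remaining sums
  -- cancel by the induction hypothesis.
  let h : ℝ → ℂ := fun x => (μ - ν) * (wave μ (-x) * twoCreation γ μ ν f z q x -
      wave μ (-x) * twoCreation γ ν μ f z x q) -
    Complex.I * γ * (wave (ν - μ) x * (wave ν (-x) * twoCreation γ μ ν f z x q) -
      wave μ (-x) * twoCreation γ ν μ f z x q)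
  have hw : ∀ x, wave (ν - μ) x * wave ν (-x) = wave μ (-x) := by
    intro x
    simp only [wave, ← Complex.exp_add]
    push_cast
    ring_nf
  have hh : ∀ x, h x = wave μ (-x) *
      ((μ - ν) * (twoCreation γ μ ν f z q x - twoCreation γ ν μ f z x q) -
      Complex.I * γ * (twoCreation γ μ ν f z x q - twoCreation γ ν μ f z x q)) := by
    intro x
    linear_combination -Complex.I * γ * twoCreation γ μ ν f z x q * hw x
  have hc : Continuous h := by
    have h1 := continuous_twoCreation γ μ ν hf (X := ℝ) (z := fun _ => z) (p := fun _ => q)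
      continuous_const continuous_const continuous_id
    have h2 := continuous_twoCreation γ ν μ hf (X := ℝ) (z := fun _ => z) (q := fun _ => q)
      continuous_const continuous_id continuous_const
    have h3 := continuous_twoCreation γ μ ν hf (X := ℝ) (z := fun _ => z) (q := fun _ => q)
      continuous_const continuous_id continuous_const
    rw [funext hh]
    exact Continuous.mul (by fun_prop) ((continuous_const.mul (h1.sub h2)).sub
      (continuous_const.mul (h3.sub h2)))
  have hd : ∀ x ∈ Set.Ico q p, HasDerivWithinAt h 0 (Set.Ici x) x := by
    intro x hx
    have d1 := hasDerivWithinAt_twoCreation_right γ μ ν hf z hx.1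
    have d2 := hasDerivWithinAt_twoCreation_left γ ν μ hf z hx.1
    have d3 := ((hasDerivAt_wave (ν - μ) x).hasDerivWithinAt (s := Set.Ici x)).fun_mul
      (hasDerivWithinAt_twoCreation_left γ μ ν hf z hx.1)
    refine (((d1.fun_sub d2).const_mul (μ - ν)).fun_sub
      ((d3.fun_sub d2).const_mul (Complex.I * γ))).congr_deriv ?_
    have hs : ∑ k, ((μ - ν) *
          ((if z k ≤ x then wave μ (-x) * twoCreation γ μ ν f (update z k x) q (z k) else 0) -
          (if z k ≤ x then wave μ (-x) * twoCreation γ ν μ f (update z k x) (z k) q else 0)) -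
        Complex.I * γ * (wave (ν - μ) x *
          (if z k ≤ x then wave ν (-x) * twoCreation γ μ ν f (update z k x) (z k) q else 0) -
          (if z k ≤ x then wave μ (-x) * twoCreation γ ν μ f (update z k x) (z k) q else 0))) =
        0 := by
      refine Finset.sum_eq_zero fun k _ => ?_
      split_ifs with hk
      · have := (ih (update z k x) (z k) q (below_update_lt (hk.trans_lt hx.2)
          (max_le hk hx.1) (max_le (hk.trans hx.2.le) hqp))).1
        linear_combination wave μ (-x) * this -
          Complex.I * γ * twoCreation γ μ ν f (update z k x) (z k) q * hw x
      · ring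
    simp only [Finset.sum_sub_distrib, ← Finset.mul_sum] at hs
    linear_combination γ * hs -
      Complex.I ^ 2 * γ * (ν - μ) * twoCreation γ μ ν f z x q * hw x -
      γ * (ν - μ) * wave μ (-x) * twoCreation γ μ ν f z x q * Complex.I_sq
  have hp := constant_of_has_deriv_right_zero hc.continuousOn hd p ⟨hqp, le_rfl⟩
  have hq0 : h q = 0 := by
    rw [hh, hdiag]
    ring
  rw [hq0, hh] at hp
  exact sub_eq_zero.1 ((mul_eq_zero.1 hp).resolve_left (Complex.exp_ne_zero _))

/-- The exchange relation of `b⁻_μ` and `b⁻_ν`. -/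
theorem twoCreation_exchange (hμν : μ ≠ ν) (z : Fin N → ℝ) (p q : ℝ) :
    (μ - ν) * (twoCreation γ μ ν f z q p - twoCreation γ ν μ f z p q) =
      Complex.I * γ * (twoCreation γ μ ν f z p q - twoCreation γ ν μ f z p q) ∧
    (ν - μ) * (twoCreation γ ν μ f z q p - twoCreation γ μ ν f z p q) =
      Complex.I * γ * (twoCreation γ ν μ f z p q - twoCreation γ μ ν f z p q) := by
  induction hn : below z (max p q) using Nat.strong_induction_on generalizing z p q with
  | _ n ih =>
  have key : ∀ p q, q ≤ p → below z p = n →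
      (μ - ν) * (twoCreation γ μ ν f z q p - twoCreation γ ν μ f z p q) =
        Complex.I * γ * (twoCreation γ μ ν f z p q - twoCreation γ ν μ f z p q) ∧
      (ν - μ) * (twoCreation γ ν μ f z q p - twoCreation γ μ ν f z p q) =
        Complex.I * γ * (twoCreation γ ν μ f z p q - twoCreation γ μ ν f z p q) := by
    intro p q hqp hb
    exact ⟨twoCreation_exchange_of_le γ μ ν hf hμν z hqp
        fun z' p' q' h => ih _ (hb ▸ h) z' p' q' rfl,
      twoCreation_exchange_of_le γ ν μ hf hμν.symm z hqp
        fun z' p' q' h => (ih _ (hb ▸ h) z' p' q' rfl).symm⟩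
  rcases le_total q p with h | h
  · exact key p q h (by rwa [max_eq_left h] at hn)
  -- At the interchanged point the two relations add up to equality of the symmetrized values, and
  -- this equality turns each of them into the required one.
  · obtain ⟨h1, h2⟩ := key q p h (by rwa [max_eq_right h] at hn)
    have hd0 : μ - ν ≠ 0 := sub_ne_zero.2 hμν
    constructor <;> refine mul_left_cancel₀ hd0 ?_
    · linear_combination (μ - ν) * h2 - Complex.I * γ * (h1 + h2)
    · linear_combination (μ - ν) * h1 + Complex.I * γ * (h1 + h2)

end

/-! ### Plane waves under $s_j^\gamma$, and the characterization of $\psi_\lambda$ -/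

theorem planeWave_comp_perm {N : ℕ} (l : Fin N → ℂ) (w : Equiv.Perm (Fin N)) :
    permAct w (planeWave (l ∘ w)) = planeWave l := by
  funext x
  exact congrArg (fun a => Complex.exp (Complex.I * a))
    (Equiv.sum_comp w fun j => l j * (x j : ℂ))

theorem permAct_swap_planeWave {N : ℕ} (l : Fin N → ℂ) (j k : Fin N) :
    permAct (Equiv.swap j k) (planeWave l) = planeWave (l ∘ Equiv.swap j k) := by
  rw [← planeWave_comp_perm (l ∘ Equiv.swap j k) (Equiv.swap j k), comp_assoc,
    ← Equiv.coe_trans, Equiv.swap_swap]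
  rfl

@[fun_prop]
theorem continuous_planeWave {X : Type*} [TopologicalSpace X] {N : ℕ} {l : X → Fin N → ℂ}
    {x : X → Fin N → ℝ} (hl : Continuous l) (hx : Continuous x) :
    Continuous fun a => planeWave (l a) (x a) := by
  unfold planeWave
  fun_prop

theorem planeWave_sub_smul {N : ℕ} (l : Fin N → ℂ) (j k : Fin N) (x : Fin N → ℝ) (y : ℝ) :
    planeWave l (x - y • (Pi.single j (1 : ℝ) - Pi.single k (1 : ℝ))) =
      planeWave l x * Complex.exp (-Complex.I * (l j - l k) * y) := by
  rw [planeWave, planeWave, ← Complex.exp_add]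
  congr 1
  have h : ∀ m : Fin N, ∑ i, l i * (((Pi.single m (1 : ℝ) : Fin N → ℝ) i : ℝ) : ℂ) = l m := by
    intro m
    simp [Pi.single_apply, apply_ite Complex.ofReal]
  simp only [Pi.sub_apply, Pi.smul_apply, smul_eq_mul, Complex.ofReal_sub, Complex.ofReal_mul,
    mul_sub, Finset.sum_sub_distrib, mul_left_comm _ (y : ℂ), ← Finset.mul_sum, h]
  ring

theorem comp_swap_eq_sub {N : ℕ} {j k : Fin N} (hjk : j ≠ k) (x : Fin N → ℝ) :
    x ∘ Equiv.swap j k =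
      x - (x j - x k) • (Pi.single j (1 : ℝ) - Pi.single k (1 : ℝ)) := by
  funext i
  rcases eq_or_ne i j with rfl | hi
  · simp [hjk]
  · rcases eq_or_ne i k with rfl | hi'
    · simp [hi]
    · simp [Equiv.swap_apply_of_ne_of_ne hi hi', hi, hi']

/-- Integrate an exponential, whose value at the upper limit is the swapped wave. The factor
$\lambda_j-\lambda_k$ is kept on the left so that coinciding entries are covered. -/
theorem intOp_planeWave {N : ℕ} {j k : Fin N} (hjk : j ≠ k) (l : Fin N → ℂ) (x : Fin N → ℝ) :
    (l j - l k) * intOp j k (planeWave l) x =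
      -Complex.I * (planeWave l x - planeWave (l ∘ Equiv.swap j k) x) := by
  have h : planeWave (l ∘ Equiv.swap j k) x = planeWave l x *
      Complex.exp (-Complex.I * (l j - l k) * (x j - x k : ℝ)) := by
    rw [← permAct_swap_planeWave, permAct, comp_swap_eq_sub hjk, planeWave_sub_smul]
  rw [h, intOp]
  simp only [planeWave_sub_smul, intervalIntegral.integral_const_mul]
  rcases eq_or_ne (l j - l k) 0 with h0 | h0
  · simp [h0]
  · rw [integral_exp_mul_complex (mul_ne_zero (neg_ne_zero.2 Complex.I_ne_zero) h0)]
    have hI := Complex.I_ne_zero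
    field_simp
    simp only [Complex.ofReal_zero, mul_zero, neg_zero, Complex.exp_zero, Complex.I_sq]
    ring

theorem Simple.ne {N : ℕ} (p : Simple N) : p.1.1 ≠ p.1.2 := fun h => by
  have := p.2
  rw [h] at this
  omega

theorem intRefl_planeWave (γ : ℝ) {N : ℕ} (p : Simple N) (l : Fin N → ℂ) (x : Fin N → ℝ) :
    (l p.1.1 - l p.1.2) * (intRefl γ p (planeWave l) x - planeWave (l ∘ simpleSwap p) x) =
      -Complex.I * γ * (planeWave l x - planeWave (l ∘ simpleSwap p) x) := by
  rw [intRefl, simpleSwap, permAct_swap_planeWave]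
  simp only [Pi.add_apply, Pi.smul_apply, smul_eq_mul]
  linear_combination γ * intOp_planeWave p.ne l x

theorem continuous_intOp {X : Type*} [TopologicalSpace X] [FirstCountableTopology X]
    [LocallyCompactSpace X] {N : ℕ} (j k : Fin N) {F : X → Fun N}
    (hF : Continuous fun q : X × (Fin N → ℝ) => F q.1 q.2) :
    Continuous fun q : X × (Fin N → ℝ) => intOp j k (F q.1) q.2 := by
  unfold intOp
  refine continuous_intervalIntegral (X := X × (Fin N → ℝ)) ?_ (by fun_prop) (by fun_prop)
  have hu : Continuous fun x : (X × (Fin N → ℝ)) × ℝ =>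
      x.1.2 - x.2 • (Pi.single j (1 : ℝ) - Pi.single k (1 : ℝ)) := by fun_prop
  exact hF.comp ((continuous_fst.comp continuous_fst).prodMk hu)

theorem continuous_permAct {X : Type*} [TopologicalSpace X] {N : ℕ} (w : Equiv.Perm (Fin N))
    {F : X → Fun N} (hF : Continuous fun q : X × (Fin N → ℝ) => F q.1 q.2) :
    Continuous fun q : X × (Fin N → ℝ) => permAct w (F q.1) q.2 := by
  have hu : Continuous fun q : X × (Fin N → ℝ) => q.2 ∘ w := by unfold comp; fun_prop
  exact hF.comp (continuous_fst.prodMk hu)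

theorem continuous_intRefl (γ : ℝ) {X : Type*} [TopologicalSpace X] [FirstCountableTopology X]
    [LocallyCompactSpace X] {N : ℕ} (p : Simple N) {F : X → Fun N}
    (hF : Continuous fun q : X × (Fin N → ℝ) => F q.1 q.2) :
    Continuous fun q : X × (Fin N → ℝ) => intRefl γ p (F q.1) q.2 :=
  (continuous_permAct _ hF).add (continuous_const.mul (continuous_intOp _ _ hF))

theorem continuous_foldr_intRefl (γ : ℝ) {X : Type*} [TopologicalSpace X]
    [FirstCountableTopology X] [LocallyCompactSpace X] {N : ℕ} (s : List (Simple N))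
    {F : X → Fun N} (hF : Continuous fun q : X × (Fin N → ℝ) => F q.1 q.2) :
    Continuous fun q : X × (Fin N → ℝ) => s.foldr (intRefl γ) (F q.1) q.2 := by
  induction s with
  | nil => exact hF
  | cons p s ih => exact continuous_intRefl γ p (F := fun a => s.foldr (intRefl γ) (F a)) ih

theorem continuous_foldr_intRefl_apply (γ : ℝ) {N : ℕ} (s : List (Simple N))
    {f : Fun N} (hf : Continuous f) : Continuous (s.foldr (intRefl γ) f) :=
  (continuous_foldr_intRefl γ (X := Unit) s (F := fun _ => f) (hf.comp continuous_snd)).comp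
    (Continuous.prodMk_right ())

theorem intOp_add {N : ℕ} (j k : Fin N) {f g : Fun N} (hf : Continuous f) (hg : Continuous g) :
    intOp j k (f + g) = intOp j k f + intOp j k g := by
  funext x
  exact intervalIntegral.integral_add ((hf.comp (by fun_prop)).intervalIntegrable ..)
    ((hg.comp (by fun_prop)).intervalIntegrable ..)

theorem intOp_smul {N : ℕ} (j k : Fin N) (c : ℂ) (f : Fun N) :
    intOp j k (c • f) = c • intOp j k f := by
  funext x
  exact intervalIntegral.integral_const_mul ..

theorem intRefl_add (γ : ℝ) {N : ℕ} (p : Simple N) {f g : Fun N} (hf : Continuous f)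
    (hg : Continuous g) : intRefl γ p (f + g) = intRefl γ p f + intRefl γ p g := by
  rw [intRefl, intOp_add _ _ hf hg, smul_add, show permAct (simpleSwap p) (f + g) =
    permAct (simpleSwap p) f + permAct (simpleSwap p) g from rfl, add_add_add_comm]
  rfl

theorem intRefl_smul (γ : ℝ) {N : ℕ} (p : Simple N) (c : ℂ) (f : Fun N) :
    intRefl γ p (c • f) = c • intRefl γ p f := by
  rw [intRefl, intOp_smul, smul_comm, intRefl, smul_add]
  rfl

theorem foldr_intRefl_add (γ : ℝ) {N : ℕ} (s : List (Simple N)) {f g : Fun N}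
    (hf : Continuous f) (hg : Continuous g) : s.foldr (intRefl γ) (f + g) =
      s.foldr (intRefl γ) f + s.foldr (intRefl γ) g := by
  induction s with
  | nil => rfl
  | cons p s ih =>
    simp only [List.foldr_cons, ih]
    exact intRefl_add γ p (continuous_foldr_intRefl_apply γ s hf)
      (continuous_foldr_intRefl_apply γ s hg)

theorem foldr_intRefl_smul (γ : ℝ) {N : ℕ} (s : List (Simple N)) (c : ℂ) (f : Fun N) :
    s.foldr (intRefl γ) (c • f) = c • s.foldr (intRefl γ) f := by
  induction s with
  | nil => rfl
  | cons p s ih => simp only [List.foldr_cons, ih, intRefl_smul]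

/-- The perturbation $\lambda_j+e\,j$ has distinct entries for all small $e\ne0$. -/
theorem dense_injective (N : ℕ) : Dense {l : Fin N → ℂ | Injective l} := by
  intro l
  have ht : Tendsto (fun (e : ℂ) (j : Fin N) => l j + e * (j : ℕ)) (𝓝[≠] 0) (𝓝 l) := by
    have h : Continuous fun (e : ℂ) (j : Fin N) => l j + e * (j : ℕ) := by fun_prop
    have h0 := h.tendsto 0
    simp only [zero_mul, add_zero] at h0
    exact h0.mono_left nhdsWithin_le_nhds
  refine mem_closure_of_tendsto ht ?_
  have h : ∀ j k : Fin N, ∀ᶠ e : ℂ in 𝓝[≠] 0, l j + e * (j : ℕ) = l k + e * (k : ℕ) → j = k := by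
    intro j k
    by_cases hjk : j = k
    · exact Eventually.of_forall fun _ _ => hjk
    have hd : ((j : ℕ) : ℂ) - (k : ℕ) ≠ 0 :=
      sub_ne_zero.2 fun h => hjk (Fin.ext (Nat.cast_injective h))
    by_cases hl : l k = l j
    · filter_upwards [self_mem_nhdsWithin] with e he heq
      refine absurd ?_ he
      exact (mul_eq_zero.1 (show e * (((j : ℕ) : ℂ) - (k : ℕ)) = 0 by
        linear_combination heq + hl)).resolve_right hd
    · have hc : (0 : ℂ) ≠ (l k - l j) / (((j : ℕ) : ℂ) - (k : ℕ)) :=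
        (div_ne_zero (sub_ne_zero.2 hl) hd).symm
      filter_upwards [nhdsWithin_le_nhds (eventually_ne_nhds hc)] with e he heq
      refine absurd ((eq_div_iff hd).2 ?_) he
      linear_combination heq
  filter_upwards [eventually_all.2 fun j => eventually_all.2 (h j)] with e he j k hjk
  exact he j k hjk

section

variable (γ : ℝ) {N : ℕ} {W : (Fin N → ℂ) → Fun N}
  (hplane : ∀ l x, Antitone x → W l x = planeWave l x)
  (hex : ∀ (p : Simple N) l x,
    (l p.1.1 - l p.1.2) * (permAct (simpleSwap p) (W l) x - W (l ∘ simpleSwap p) x) =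
      -Complex.I * γ * (W l x - W (l ∘ simpleSwap p) x))

include hex in
-- Plane waves under $s_j^\gamma$ and the family $W$ under $s_j$ obey the same exchange relation. As
-- the $\lambda_j$ are distinct, it can be solved for the image, so the span of the pairs is stable
-- under the simultaneous action, with the same coefficients in both components.
theorem foldr_mem_span_of_exchange {l : Fin N → ℂ} (hl : Injective l) (s : List (Simple N)) :
    (s.foldr (intRefl γ) (planeWave l), permAct (s.map simpleSwap).prod (W l)) ∈
      Submodule.span ℂ (Set.range fun v : Equiv.Perm (Fin N) =>
        (planeWave (l ∘ v), W (l ∘ v))) := by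
  induction s with
  | nil => exact Submodule.subset_span ⟨1, rfl⟩
  | cons p s ih =>
    have key : ∀ FG ∈ Submodule.span ℂ (Set.range fun v : Equiv.Perm (Fin N) =>
          (planeWave (l ∘ v), W (l ∘ v))),
        Continuous FG.1 ∧ (intRefl γ p FG.1, permAct (simpleSwap p) FG.2) ∈
          Submodule.span ℂ (Set.range fun v : Equiv.Perm (Fin N) =>
            (planeWave (l ∘ v), W (l ∘ v))) := by
      intro FG h
      induction h using Submodule.span_induction with
      | mem FG h =>
        obtain ⟨v, rfl⟩ := h
        refine ⟨continuous_planeWave continuous_const continuous_id, ?_⟩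
        have hd : (l ∘ v) p.1.1 - (l ∘ v) p.1.2 ≠ 0 :=
          sub_ne_zero.2 fun h => p.ne (v.injective (hl h))
        set c : ℂ := -Complex.I * γ / ((l ∘ v) p.1.1 - (l ∘ v) p.1.2) with hc
        have e : (intRefl γ p (planeWave (l ∘ v)), permAct (simpleSwap p) (W (l ∘ v))) =
            c • (planeWave (l ∘ v), W (l ∘ v)) +
            (1 - c) • (planeWave (l ∘ ⇑(v * simpleSwap p)), W (l ∘ ⇑(v * simpleSwap p))) := by
          have hcd : ((l ∘ v) p.1.1 - (l ∘ v) p.1.2) * c = -Complex.I * γ := by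
            rw [hc, mul_div_cancel₀ _ hd]
          refine Prod.ext (funext fun x => ?_) (funext fun x => ?_) <;>
            refine mul_left_cancel₀ hd ?_ <;>
            simp only [Prod.fst_add, Prod.snd_add, Prod.smul_fst, Prod.smul_snd, Pi.add_apply,
              Pi.smul_apply, smul_eq_mul, Equiv.Perm.coe_mul, ← comp_assoc]
          · linear_combination intRefl_planeWave γ p (l ∘ v) x -
              (planeWave (l ∘ v) x - planeWave ((l ∘ v) ∘ simpleSwap p) x) * hcd
          · linear_combination hex p (l ∘ v) x -
              (W (l ∘ v) x - W ((l ∘ v) ∘ simpleSwap p) x) * hcd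
        simp only [e]
        exact add_mem (Submodule.smul_mem _ _ (Submodule.subset_span ⟨v, rfl⟩))
          (Submodule.smul_mem _ _ (Submodule.subset_span ⟨v * simpleSwap p, rfl⟩))
      | zero =>
        refine ⟨continuous_zero, ?_⟩
        have := intRefl_smul γ p 0 (0 : Fun N)
        rw [zero_smul, zero_smul] at this
        simp only [Prod.fst_zero, this]
        exact zero_mem _
      | add FG FG' _ _ h h' =>
        refine ⟨h.1.add h'.1, ?_⟩
        rw [Prod.fst_add, intRefl_add γ p h.1 h'.1]
        exact add_mem h.2 h'.2
      | smul c FG _ h =>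
        refine ⟨h.1.const_smul c, ?_⟩
        rw [Prod.smul_fst, intRefl_smul]
        exact Submodule.smul_mem _ c h.2
    exact (key _ ih).2

include hplane in
theorem eq_of_mem_span_of_antitone {l : Fin N → ℂ} {x : Fin N → ℝ} (hx : Antitone x)
    {FG : Fun N × Fun N} (h : FG ∈ Submodule.span ℂ (Set.range fun v : Equiv.Perm (Fin N) =>
      (planeWave (l ∘ v), W (l ∘ v)))) : FG.1 x = FG.2 x := by
  induction h using Submodule.span_induction with
  | mem FG h =>
    obtain ⟨v, rfl⟩ := h
    exact (hplane _ _ hx).symm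
  | zero => rfl
  | add FG FG' _ _ h h' => simp only [Prod.fst_add, Prod.snd_add, Pi.add_apply, h, h']
  | smul c FG _ h => simp only [Prod.smul_fst, Prod.smul_snd, Pi.smul_apply, h]

theorem antitone_comp_chamber_inv (x : Fin N → ℝ) : Antitone (x ∘ ⇑(chamber x)⁻¹) := by
  have h := Tuple.monotone_sort fun j => -x j
  rw [chamber, inv_inv]
  exact fun a b hab => neg_le_neg_iff.1 (h hab)

include hplane hex in
/-- A family of functions depending continuously on `λ`, which agrees with the plane waves on the
fundamental alcove and satisfies their exchange relations, consists of the `ψ_λ`. -/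
theorem psi_eq_of_exchange (hcont : ∀ x, Continuous fun l => W l x) (l : Fin N → ℂ) :
    psi γ l = W l := by
  funext x
  have hc : Continuous fun l => psi γ l x := by
    unfold psi propagation permAct intReflPerm
    exact (continuous_foldr_intRefl γ (X := Fin N → ℂ) (word (chamber x)) (F := planeWave)
      (continuous_planeWave continuous_fst continuous_snd)).comp (Continuous.prodMk_left _)
  refine congrFun (hc.ext_on (dense_injective N) (hcont x) fun l hl => ?_) l
  -- On decreasing vectors $w^\gamma e^{i\lambda}$ and $wW_\lambda$ agree; taking $w$ to be the
  -- chamber of $x$ turns this into the claim at $x$.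
  have h := eq_of_mem_span_of_antitone hplane (antitone_comp_chamber_inv x)
    (foldr_mem_span_of_exchange γ hex hl (word (chamber x)))
  have hw : ((word (chamber x)).map simpleSwap).prod = chamber x :=
    (exists_word (chamber x)).choose_spec
  rw [hw] at h
  simp only [psi, propagation, permAct, intReflPerm] at h ⊢
  rw [h, comp_assoc]
  congr 1
  funext j
  simp

end

/-! ### Identification of $\psi_\lambda$ with $b^-_{\lambda_N}\cdots b^-_{\lambda_1}1$ -/

/-- The functions `b⁻_{λ_N} ⋯ b⁻_{λ_1} 1`. -/
noncomputable def minusWave (γ : ℝ) : (N : ℕ) → (Fin N → ℂ) → Fun N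
  | 0, _ => fun _ => 1
  | N + 1, l => creation γ .minus (l (Fin.last N)) (minusWave γ N (Fin.init l))

theorem minusWave_succ_apply (γ : ℝ) {N : ℕ} (l : Fin (N + 1) → ℂ) (x : Fin (N + 1) → ℝ) :
    minusWave γ (N + 1) l x = lastCreation γ (l (Fin.last N)) (minusWave γ N (Fin.init l))
      (Fin.init x) (x (Fin.last N)) :=
  creation_minus_apply ..

theorem continuous_minusWave (γ : ℝ) (N : ℕ) : Continuous fun q : (Fin N → ℂ) × (Fin N → ℝ) =>
    minusWave γ N q.1 q.2 := by
  induction N with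
  | zero => exact continuous_const
  | succ N ih =>
    simp only [minusWave_succ_apply]
    have hl : Continuous fun q : ((Fin (N + 1) → ℂ) × (Fin (N + 1) → ℝ)) × (Fin N → ℝ) =>
        (Fin.init q.1.1 : Fin N → ℂ) := by
      unfold Fin.init; fun_prop
    have hx : Continuous fun q : (Fin (N + 1) → ℂ) × (Fin (N + 1) → ℝ) =>
        (Fin.init q.2 : Fin N → ℝ) := by
      unfold Fin.init; fun_prop
    exact continuous_lastCreation γ (f := fun q : (Fin (N + 1) → ℂ) × (Fin (N + 1) → ℝ) =>
      minusWave γ N (Fin.init q.1)) (by fun_prop) (ih.comp (hl.prodMk continuous_snd)) hx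
      (by fun_prop)

theorem continuous_minusWave_apply (γ : ℝ) {N : ℕ} (l : Fin N → ℂ) :
    Continuous (minusWave γ N l) :=
  (continuous_minusWave γ N).comp (Continuous.prodMk_right l)

theorem minusWave_of_antitone (γ : ℝ) {N : ℕ} (l : Fin N → ℂ) {x : Fin N → ℝ} (hx : Antitone x) :
    minusWave γ N l x = planeWave l x := by
  induction N with
  | zero => simp [minusWave, planeWave]
  | succ N ih =>
    have hlow : ∀ j, x (Fin.last N) ≤ Fin.init x j := fun j => hx (Fin.le_last _)
    rw [minusWave_succ_apply, lastCreation_of_le γ _ (continuous_minusWave_apply γ _) hlow, ih _ (x := Fin.init x)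
      fun a b hab => hx (Fin.castSucc_le_castSucc_iff.2 hab)]
    rw [wave, planeWave, planeWave, ← Complex.exp_add, Fin.sum_univ_castSucc]
    simp only [Fin.init]
    ring_nf

theorem lastCreation_sub_fun (γ : ℝ) (μ : ℂ) {N : ℕ} {f g : Fun N} (hf : Continuous f)
    (hg : Continuous g) (z : Fin N → ℝ) (p : ℝ) :
    lastCreation γ μ (f - g) z p = lastCreation γ μ f z p - lastCreation γ μ g z p := by
  rw [sub_eq_add_neg, ← neg_one_smul ℂ g, lastCreation_add γ μ hf (hg.const_smul (-1 : ℂ)),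
    lastCreation_smul]
  ring

/-- For the last two indices this is `twoCreation_exchange`. For any other pair the relation already
holds before the last creation operator is applied, and that operator is linear and commutes with
permutations of the earlier coordinates. -/
theorem minusWave_exchange (γ : ℝ) {N : ℕ} (p : Simple N) (l : Fin N → ℂ) (x : Fin N → ℝ) :
    (l p.1.1 - l p.1.2) *
        (permAct (simpleSwap p) (minusWave γ N l) x - minusWave γ N (l ∘ simpleSwap p) x) =
      -Complex.I * γ * (minusWave γ N l x - minusWave γ N (l ∘ simpleSwap p) x) := by
  induction N with
  | zero => exact p.1.1.elim0
  | succ N ih =>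
    obtain ⟨⟨j, k⟩, hp⟩ := p
    simp only at hp
    simp only [simpleSwap]
    induction k using Fin.lastCases with
    | last =>
      obtain ⟨M, rfl⟩ : ∃ M, N = M + 1 := ⟨j, by simpa using hp.symm⟩
      obtain rfl : j = (Fin.last M).castSucc := Fin.ext (by simpa using hp)
      by_cases hl : l (Fin.last M).castSucc = l (Fin.last (M + 1))
      · have : l ∘ Equiv.swap (Fin.last M).castSucc (Fin.last (M + 1)) = l := by
          funext i
          simp only [comp_apply, Equiv.swap_apply_def]
          split_ifs with h1 h2
          · rw [h1, hl]
          · rw [h2, hl]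
          · rfl
        rw [this, hl]
        ring
      have hW : ∀ (l : Fin (M + 2) → ℂ) (x : Fin (M + 2) → ℝ), minusWave γ (M + 2) l x =
          twoCreation γ (l (Fin.last (M + 1))) (l (Fin.last M).castSucc)
            (minusWave γ M (Fin.init (Fin.init l))) (Fin.init (Fin.init x))
            (x (Fin.last M).castSucc) (x (Fin.last (M + 1))) := by
        intro l x
        rw [minusWave_succ_apply, twoCreation]
        have h1 : minusWave γ (M + 1) (Fin.init l) = fun x : Fin (M + 1) → ℝ =>
            lastCreation γ (l (Fin.last M).castSucc) (minusWave γ M (Fin.init (Fin.init l)))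
              (Fin.init x) (x (Fin.last M)) := by
          funext x
          rw [minusWave_succ_apply]
          rfl
        have h2 : (Fin.snoc (α := fun _ => ℝ) (Fin.init (Fin.init x)) (x (Fin.last M).castSucc)) =
            Fin.init x := Fin.snoc_init_self (Fin.init x)
        rw [h1, h2]
      have hi : ∀ {α : Type} (y : Fin (M + 2) → α), (Fin.init (Fin.init
          (y ∘ Equiv.swap (Fin.last M).castSucc (Fin.last (M + 1)))) : Fin M → α) =
          Fin.init (Fin.init y) := by
        intro α y
        funext i
        simp only [Fin.init, comp_apply]
        rw [Equiv.swap_apply_of_ne_of_ne]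
        · exact fun h => (Fin.castSucc_lt_last i).ne (Fin.castSucc_injective _ h)
        · exact (Fin.castSucc_lt_last _).ne
      rw [permAct, hW, hW, hW]
      simp only [hi, comp_apply, Equiv.swap_apply_left, Equiv.swap_apply_right]
      linear_combination -(twoCreation_exchange γ _ _ (continuous_minusWave_apply γ _)
        (Ne.symm hl) (Fin.init (Fin.init x)) (x (Fin.last M).castSucc) (x (Fin.last (M + 1)))).1
    | cast k =>
      induction j using Fin.lastCases with
      | last =>
        have := k.2
        simp only [Fin.val_last, Fin.val_castSucc] at hp
        omega
      | cast j =>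
        have hi : ∀ {α : Type} (y : Fin (N + 1) → α), (Fin.init
            (y ∘ Equiv.swap j.castSucc k.castSucc) : Fin N → α) =
            (Fin.init y : Fin N → α) ∘ Equiv.swap j k := by
          intro α y
          funext i
          simp only [Fin.init, comp_apply]
          rw [(Fin.castSucc_injective N).map_swap]
        have hlast : Equiv.swap j.castSucc k.castSucc (Fin.last N) = Fin.last N :=
          Equiv.swap_apply_of_ne_of_ne (Fin.castSucc_lt_last j).ne' (Fin.castSucc_lt_last k).ne'
        rw [permAct, minusWave_succ_apply, minusWave_succ_apply, minusWave_succ_apply]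
        simp only [hi, comp_apply, hlast]
        rw [← lastCreation_permAct]
        set f := minusWave γ N (Fin.init l) with hf
        set g := minusWave γ N (Fin.init l ∘ Equiv.swap j k) with hg
        have hfc : Continuous f := continuous_minusWave_apply γ _
        have hgc : Continuous g := continuous_minusWave_apply γ _
        have hpc : Continuous (permAct (Equiv.swap j k) f) :=
          hfc.comp (by unfold comp; fun_prop)
        have h : (l j.castSucc - l k.castSucc) • (permAct (Equiv.swap j k) f - g) =
            (-Complex.I * γ) • (f - g) :=
          funext fun y => ih ⟨(j, k), by simpa using hp⟩ (Fin.init l) y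
        have h' := congrArg (fun F => lastCreation γ (l (Fin.last N)) F (Fin.init x)
          (x (Fin.last N))) h
        simpa only [lastCreation_smul, lastCreation_sub_fun _ _ hpc hgc,
          lastCreation_sub_fun _ _ hfc hgc] using h'

/-- The functions `ψ_λ` are obtained from the constant function by the operators `b⁻`. -/
theorem psi_eq_minusWave (γ : ℝ) {N : ℕ} (l : Fin N → ℂ) : psi γ l = minusWave γ N l :=
  psi_eq_of_exchange γ (fun l _ hx => minusWave_of_antitone γ l hx) (minusWave_exchange γ)
    (fun _ => (continuous_minusWave γ N).comp (Continuous.prodMk_left _)) l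

theorem continuous_psi (γ : ℝ) {N : ℕ} (l : Fin N → ℂ) : Continuous (psi γ l) :=
  psi_eq_minusWave γ l ▸ continuous_minusWave_apply γ l

theorem creation_minus_psi (γ : ℝ) {N : ℕ} (μ : ℂ) (l : Fin N → ℂ) :
    creation γ .minus μ (psi γ l) = psi γ (Fin.snoc (α := fun _ => ℂ) l μ) := by
  rw [psi_eq_minusWave, psi_eq_minusWave, minusWave, Fin.init_snoc, Fin.snoc_last]

theorem psi_exchange (γ : ℝ) {N : ℕ} (p : Simple N) (l : Fin N → ℂ) (x : Fin N → ℝ) :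
    (l p.1.1 - l p.1.2) *
        (permAct (simpleSwap p) (psi γ l) x - psi γ (l ∘ simpleSwap p) x) =
      -Complex.I * γ * (psi γ l x - psi γ (l ∘ simpleSwap p) x) := by
  simp only [psi_eq_minusWave]
  exact minusWave_exchange γ p l x

/-! ### Reflection and the operator $b^+$ -/

/-- The tuple `(-x_N, …, -x_1)`. -/
def negRev {R : Type*} [Neg R] {N : ℕ} (x : Fin N → R) : Fin N → R := fun j => -x j.rev

theorem negRev_negRev {R : Type*} [InvolutiveNeg R] {N : ℕ} (x : Fin N → R) :
    negRev (negRev x) = x := by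
  funext j
  simp [negRev]

/-- The function `x ↦ f (-x_N, …, -x_1)`. -/
def reflect {N : ℕ} (f : Fun N) : Fun N := fun x => f (negRev x)

theorem reflect_reflect {N : ℕ} (f : Fun N) : reflect (reflect f) = f := by
  funext x
  simp only [reflect, negRev_negRev]

theorem continuous_negRev {R : Type*} [Neg R] [TopologicalSpace R] [ContinuousNeg R] (N : ℕ) :
    Continuous (negRev : (Fin N → R) → Fin N → R) := by
  unfold negRev
  fun_prop

theorem continuous_replaceAt {N n : ℕ} (i : Fin n ↪ Fin N) (z : Fin N → ℝ) :
    Continuous fun y => replaceAt i y z := by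
  refine continuous_pi fun k => ?_
  by_cases hk : ∃ m, i m = k
  · obtain ⟨m, rfl⟩ := hk
    simp only [replaceAt, i.injective.extend_apply]
    fun_prop
  · simp only [replaceAt, extend_apply' _ _ _ hk]
    fun_prop

theorem negRev_minusChain {N n : ℕ} (i : Fin n ↪ Fin N) (x : Fin (N + 1) → ℝ)
    (k : Fin (n + 1)) :
    negRev x (minusChain (Equiv.embeddingCongr Fin.revPerm Fin.revPerm i) k) =
      -x (plusChain i k.rev) := by
  induction k using Fin.cases with
  | zero => simp [negRev, minusChain, plusChain]
  | succ k => simp [negRev, minusChain, plusChain, Fin.rev_succ, Fin.rev_castSucc]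

/-- The reflection reverses a descending chain ending at $x_1$ into one starting at the last
coordinate, and replaces $\mu$ by $-\mu$ in the exponentials. -/
theorem ePlus_eq_eMinus (μ : ℂ) {N n : ℕ} (i : Fin n ↪ Fin N) {f : Fun N} (hf : Continuous f)
    (x : Fin (N + 1) → ℝ) :
    ePlus μ i f x = eMinus (-μ) (Equiv.embeddingCongr Fin.revPerm Fin.revPerm i) (reflect f)
      (negRev x) := by
  set i' := Equiv.embeddingCongr Fin.revPerm Fin.revPerm i with hi'
  have hi'm : ∀ m, i' m = (i m.rev).rev := fun m => rfl
  rw [ePlus, eMinus]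
  simp only [hi', negRev_minusChain, Fin.rev_succ, Fin.rev_castSucc, neg_lt_neg_iff]
  refine if_congr ⟨fun h m => h m.rev, fun h m => by simpa using h m.rev⟩ ?_ rfl
  congr 1
  · simp [negRev]
  · rw [iterInt_neg_rev]
    · congr 1
      funext y
      congr 1
      · rw [← Equiv.prod_comp Fin.revPerm]
        refine Finset.prod_congr rfl fun m _ => ?_
        rw [hi'm]
        simp only [Fin.revPerm_apply, Fin.rev_rev, negRev, Fin.rev_castSucc]
        push_cast
        ring_nf
      · refine congrArg f (funext fun k => ?_)
        by_cases hk : ∃ m, i m = k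
        · obtain ⟨m, rfl⟩ := hk
          have : (i m).rev = i' m.rev := by rw [hi'm, Fin.rev_rev]
          simp only [replaceAt, negRev]
          rw [i.injective.extend_apply, this, i'.injective.extend_apply]
        · simp only [replaceAt, negRev]
          rw [extend_apply' _ _ _ hk, extend_apply']
          · simp [Fin.rev_castSucc]
          · rintro ⟨m, hm⟩
            exact hk ⟨m.rev, Fin.rev_injective (by rw [← hm, hi'm])⟩
    · refine Continuous.mul (by fun_prop) (hf.comp (continuous_replaceAt i _))

theorem creation_plus_eq_reflect (γ : ℝ) (μ : ℂ) {N : ℕ} {f : Fun N} (hf : Continuous f) :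
    creation γ .plus μ f = reflect (creation γ .minus (-μ) (reflect f)) := by
  funext x
  simp only [reflect, creation, Finset.sum_apply, Pi.smul_apply, smul_eq_mul, elemCreation]
  refine Finset.sum_congr rfl fun n _ => congrArg _ ?_
  simp only [ePlus_eq_eMinus μ _ hf]
  exact Equiv.sum_comp (Equiv.embeddingCongr Fin.revPerm Fin.revPerm)
    fun i => eMinus (-μ) i (reflect f) (negRev x)

theorem negRev_comp_swap {R : Type*} [Neg R] {N : ℕ} (x : Fin N → R) (j k : Fin N) :
    negRev (x ∘ Equiv.swap j k) = negRev x ∘ Equiv.swap k.rev j.rev := by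
  funext i
  simp only [negRev, comp_apply]
  rw [Fin.rev_injective.map_swap, Fin.rev_rev, Fin.rev_rev, Equiv.swap_comm]

/-- The reflected family satisfies the same characterization: decreasing vectors stay decreasing,
simple transpositions stay simple, and reversal and negation together preserve the sign of
$\lambda_j-\lambda_{j+1}$. -/
theorem psi_eq_reflect (γ : ℝ) {N : ℕ} (l : Fin N → ℂ) :
    psi γ l = reflect (psi γ (negRev l)) := by
  refine psi_eq_of_exchange γ (W := fun l => reflect (psi γ (negRev l))) ?_ ?_ ?_ l
  · intro l x hx
    rw [reflect, psi_eq_minusWave, minusWave_of_antitone]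
    · rw [planeWave, planeWave, ← Equiv.sum_comp Fin.revPerm]
      simp [negRev]
    · exact fun a b hab => neg_le_neg (hx (Fin.rev_le_rev.2 hab))
  · intro p l x
    have hp := p.2
    have h := psi_exchange γ ⟨(p.1.2.rev, p.1.1.rev), by simp only [Fin.val_rev]; omega⟩
      (negRev l) (negRev x)
    simp only [reflect, permAct, simpleSwap, negRev_comp_swap] at h ⊢
    rw [← h]
    simp only [negRev, Fin.rev_rev]
    ring
  · intro x
    simp only [reflect, psi_eq_minusWave]
    exact (continuous_minusWave γ N).comp ((continuous_negRev N).prodMk continuous_const)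

theorem creation_plus_psi (γ : ℝ) {N : ℕ} (μ : ℂ) (l : Fin N → ℂ) :
    creation γ .plus μ (psi γ l) = psi γ (Fin.cons (α := fun _ => ℂ) μ l) := by
  rw [creation_plus_eq_reflect γ μ (continuous_psi γ l), psi_eq_reflect γ l, reflect_reflect,
    creation_minus_psi, psi_eq_reflect γ (Fin.cons (α := fun _ => ℂ) μ l)]
  congr 2
  funext j
  induction j using Fin.lastCases with
  | last => simp [negRev]
  | cast j => simp [negRev, Fin.rev_castSucc]

/-! ### The propagation operator and divided differences of $\psi_\lambda$ -/

theorem propagation_add (γ : ℝ) {N : ℕ} {f g : Fun N} (hf : Continuous f) (hg : Continuous g) :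
    propagation γ (f + g) = propagation γ f + propagation γ g := by
  funext x
  simp only [propagation, intReflPerm, foldr_intRefl_add γ _ hf hg]
  rfl

theorem propagation_smul (γ : ℝ) {N : ℕ} (c : ℂ) (f : Fun N) :
    propagation γ (c • f) = c • propagation γ f := by
  funext x
  simp only [propagation, intReflPerm, foldr_intRefl_smul]
  rfl

/-- There are finitely many chambers, and the formula of each is jointly continuous in the parameter
and the point. The estimate holds for all of them at once, so continuity across the hyperplanes is
not needed. -/
theorem tendstoLocallyUniformly_propagation (γ : ℝ) {N : ℕ} {F : ℂ → Fun N}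
    (hF : Continuous fun q : ℂ × (Fin N → ℝ) => F q.1 q.2) (μ : ℂ) :
    TendstoLocallyUniformly (fun ν => propagation γ (F ν)) (propagation γ (F μ)) (𝓝 μ) := by
  rw [tendstoLocallyUniformly_iff_forall_tendsto]
  intro x u hu
  have h : ∀ w : Equiv.Perm (Fin N), ∀ᶠ y : ℂ × (Fin N → ℝ) in 𝓝 μ ×ˢ 𝓝 x,
      ((word w).foldr (intRefl γ) (F μ) (y.2 ∘ ⇑w⁻¹),
        (word w).foldr (intRefl γ) (F y.1) (y.2 ∘ ⇑w⁻¹)) ∈ u := by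
    intro w
    have hw : Continuous fun y : ℂ × (Fin N → ℝ) => y.2 ∘ ⇑w⁻¹ := by unfold comp; fun_prop
    have hc := continuous_foldr_intRefl γ (word w) hF
    have h1 : Continuous fun y : ℂ × (Fin N → ℝ) =>
        ((word w).foldr (intRefl γ) (F μ) (y.2 ∘ ⇑w⁻¹),
          (word w).foldr (intRefl γ) (F y.1) (y.2 ∘ ⇑w⁻¹)) :=
      (hc.comp (continuous_const.prodMk hw)).prodMk (hc.comp (continuous_fst.prodMk hw))
    rw [← nhds_prod_eq]
    exact h1.tendsto (μ, x) (nhds_le_uniformity _ hu)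
  have h' := eventually_all.2 h
  rw [mem_map]
  filter_upwards [h'] with y hy
  exact hy (chamber y.2)

theorem continuous_planeWave_apply {N : ℕ} (l : Fin N → ℂ) : Continuous (planeWave l) :=
  continuous_planeWave continuous_const continuous_id

theorem continuous_intOp_planeWave {N : ℕ} (j k : Fin N) (l : Fin N → ℂ) :
    Continuous (intOp j k (planeWave l)) := by
  have h := continuous_intOp j k (X := Unit) (F := fun _ => planeWave l)
    ((continuous_planeWave_apply l).comp continuous_snd)
  have hu : Continuous fun x : Fin N → ℝ => ((), x) := by fun_prop
  have h' := h.comp hu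
  simp only [comp_def] at h'
  exact h'

/-- The factor $\lambda_j-\lambda_{j+1}$ is exhibited explicitly, so dividing by it leaves an
expression that is regular when the two entries coincide. -/
theorem psi_sub_psi_comp_swap (γ : ℝ) {N : ℕ} (p : Simple N) (l : Fin N → ℂ) :
    psi γ l - psi γ (l ∘ simpleSwap p) =
      (Complex.I * (l p.1.1 - l p.1.2)) •
        propagation γ (intOp p.1.1 p.1.2 (planeWave l)) := by
  have h : planeWave l = planeWave (l ∘ simpleSwap p) +
      (Complex.I * (l p.1.1 - l p.1.2)) • intOp p.1.1 p.1.2 (planeWave l) := by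
    funext x
    have := intOp_planeWave p.ne l x
    simp only [Pi.add_apply, Pi.smul_apply, smul_eq_mul, simpleSwap]
    linear_combination -Complex.I * this +
      (planeWave l x - planeWave (l ∘ Equiv.swap p.1.1 p.1.2) x) * Complex.I_sq
  rw [psi, psi, sub_eq_iff_eq_add', ← propagation_smul, ← propagation_add γ
    (continuous_planeWave_apply _)
    ((continuous_intOp_planeWave _ _ _).const_smul _), ← h]

/-! ### The relations on the spans $\mathfrak z_N$ -/

/-- `(μ, λ)` for the sign `+` and `(λ, μ)` for the sign `-`. -/
def adjoin (ε : Sgn) (μ : ℂ) {N : ℕ} (l : Fin N → ℂ) : Fin (N + 1) → ℂ :=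
  match ε with
  | .plus => Fin.cons (α := fun _ => ℂ) μ l
  | .minus => Fin.snoc (α := fun _ => ℂ) l μ

/-- The pair of indices transposed by `s^ε`. -/
def edgePair (N : ℕ) (ε : Sgn) : Simple (N + 2) :=
  match ε with
  | .plus => ⟨(0, 1), by simp⟩
  | .minus => ⟨((Fin.last N).castSucc, Fin.last (N + 1)), by simp⟩

theorem simpleSwap_edgePair (N : ℕ) (ε : Sgn) : simpleSwap (edgePair N ε) = edgeSwap N ε := by
  cases ε <;> rfl

theorem creation_psi (γ : ℝ) (ε : Sgn) (μ : ℂ) {N : ℕ} (l : Fin N → ℂ) :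
    creation γ ε μ (psi γ l) = psi γ (adjoin ε μ l) := by
  cases ε
  · exact creation_plus_psi γ μ l
  · exact creation_minus_psi γ μ l

theorem adjoin_adjoin_edgePair (ε : Sgn) (μ ν : ℂ) {N : ℕ} (l : Fin N → ℂ) :
    adjoin ε μ (adjoin ε ν l) (edgePair N ε).1.1 - adjoin ε μ (adjoin ε ν l) (edgePair N ε).1.2 =
      ε.val * (μ - ν) := by
  cases ε
  · simp only [adjoin, edgePair, Sgn.val, Fin.cons_zero, ← Fin.succ_zero_eq_one, Fin.cons_succ]
    ring
  · simp only [adjoin, edgePair, Sgn.val, Fin.snoc_last, Fin.snoc_castSucc]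
    ring

theorem adjoin_adjoin_comp_edgeSwap (ε : Sgn) (μ ν : ℂ) {N : ℕ} (l : Fin N → ℂ) :
    adjoin ε μ (adjoin ε ν l) ∘ edgeSwap N ε = adjoin ε ν (adjoin ε μ l) := by
  funext j
  cases ε
  · simp only [comp_apply, edgeSwap, adjoin]
    induction j using Fin.cases with
    | zero => rw [Equiv.swap_apply_left]; rfl
    | succ j =>
      induction j using Fin.cases with
      | zero => rw [Fin.succ_zero_eq_one, Equiv.swap_apply_right]; rfl
      | succ j =>
        rw [Equiv.swap_apply_of_ne_of_ne (Fin.succ_ne_zero _)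
          (by rw [← Fin.succ_zero_eq_one]
              exact fun h => Fin.succ_ne_zero j (Fin.succ_injective _ h))]
        rfl
  · simp only [comp_apply, edgeSwap, adjoin]
    induction j using Fin.lastCases with
    | last => rw [Equiv.swap_apply_right]; simp
    | cast j =>
      induction j using Fin.lastCases with
      | last => rw [Equiv.swap_apply_left]; simp
      | cast j =>
        rw [Equiv.swap_apply_of_ne_of_ne
          (fun h => (Fin.castSucc_lt_last j).ne (Fin.castSucc_injective _ h))
          (Fin.castSucc_lt_last _).ne]
        simp

theorem continuous_adjoin {X : Type*} [TopologicalSpace X] (ε : Sgn) {N : ℕ} {μ : X → ℂ}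
    {l : X → Fin N → ℂ} (hμ : Continuous μ) (hl : Continuous l) :
    Continuous fun a => adjoin ε (μ a) (l a) := by
  cases ε <;> simp only [adjoin]
  · exact Continuous.finCons hμ hl
  · exact Continuous.finSnoc hl hμ

theorem continuous_adjoin_adjoin (ε : Sgn) (μ : ℂ) {N : ℕ} (l : Fin N → ℂ) :
    Continuous fun ν => adjoin ε μ (adjoin ε ν l) :=
  continuous_adjoin ε continuous_const (continuous_adjoin ε continuous_id continuous_const)

theorem continuous_of_mem_zSpan {γ : ℝ} {N : ℕ} {f : Fun N} (hf : f ∈ zSpan γ N) :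
    Continuous f := by
  induction hf using Submodule.span_induction with
  | mem f h =>
    obtain ⟨l, rfl⟩ := h
    exact continuous_psi γ l
  | zero => exact continuous_zero
  | add f g _ _ hf hg => exact hf.add hg
  | smul c f _ hf => exact hf.const_smul c

theorem creation_minus_add (γ : ℝ) (μ : ℂ) {N : ℕ} {f g : Fun N} (hf : Continuous f)
    (hg : Continuous g) :
    creation γ .minus μ (f + g) = creation γ .minus μ f + creation γ .minus μ g := by
  funext x
  simp only [Pi.add_apply, creation_minus_apply, lastCreation_add γ μ hf hg]

theorem creation_minus_smul (γ : ℝ) (μ c : ℂ) {N : ℕ} (f : Fun N) :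
    creation γ .minus μ (c • f) = c • creation γ .minus μ f := by
  funext x
  simp only [Pi.smul_apply, smul_eq_mul, creation_minus_apply, lastCreation_smul]

theorem creation_add {γ : ℝ} (ε : Sgn) (μ : ℂ) {N : ℕ} {f g : Fun N} (hf : f ∈ zSpan γ N)
    (hg : g ∈ zSpan γ N) :
    creation γ ε μ (f + g) = creation γ ε μ f + creation γ ε μ g := by
  have hf' := continuous_of_mem_zSpan hf
  have hg' := continuous_of_mem_zSpan hg
  have hf'' : Continuous (reflect f) := hf'.comp (continuous_negRev N)
  have hg'' : Continuous (reflect g) := hg'.comp (continuous_negRev N)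
  cases ε
  · rw [creation_plus_eq_reflect γ μ (hf'.add hg'), creation_plus_eq_reflect γ μ hf',
      creation_plus_eq_reflect γ μ hg', show reflect (f + g) = reflect f + reflect g from rfl,
      creation_minus_add γ (-μ) hf'' hg'']
    rfl
  · exact creation_minus_add γ μ hf' hg'

theorem creation_smul {γ : ℝ} (ε : Sgn) (μ c : ℂ) {N : ℕ} {f : Fun N} (hf : f ∈ zSpan γ N) :
    creation γ ε μ (c • f) = c • creation γ ε μ f := by
  have hf' := continuous_of_mem_zSpan hf
  cases ε
  · rw [creation_plus_eq_reflect γ μ (hf'.const_smul c), creation_plus_eq_reflect γ μ hf',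
      show reflect (c • f) = c • reflect f from rfl, creation_minus_smul]
    rfl
  · exact creation_minus_smul γ μ c f

theorem creation_zero (γ : ℝ) (ε : Sgn) (μ : ℂ) {N : ℕ} :
    creation γ ε μ (0 : Fun N) = 0 := by
  simpa using creation_smul ε μ 0 (zero_mem (zSpan γ N))

theorem creation_mem {γ : ℝ} (ε : Sgn) (μ : ℂ) {N : ℕ} {f : Fun N} (hf : f ∈ zSpan γ N) :
    creation γ ε μ f ∈ zSpan γ (N + 1) := by
  induction hf using Submodule.span_induction with
  | mem f h =>
    obtain ⟨l, rfl⟩ := h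
    exact Submodule.subset_span ⟨_, (creation_psi γ ε μ l).symm⟩
  | zero => exact creation_zero γ ε μ ▸ zero_mem _
  | add f g hf hg h h' => exact creation_add ε μ hf hg ▸ add_mem h h'
  | smul c f hf h => exact creation_smul ε μ c hf ▸ Submodule.smul_mem _ c h

theorem creation_creation_add {γ : ℝ} (ε ε' : Sgn) (μ ν : ℂ) {N : ℕ} {f g : Fun N}
    (hf : f ∈ zSpan γ N) (hg : g ∈ zSpan γ N) :
    creation γ ε μ (creation γ ε' ν (f + g)) =
      creation γ ε μ (creation γ ε' ν f) + creation γ ε μ (creation γ ε' ν g) := by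
  rw [creation_add ε' ν hf hg, creation_add ε μ (creation_mem ε' ν hf) (creation_mem ε' ν hg)]

theorem creation_creation_smul {γ : ℝ} (ε ε' : Sgn) (μ ν c : ℂ) {N : ℕ} {f : Fun N}
    (hf : f ∈ zSpan γ N) :
    creation γ ε μ (creation γ ε' ν (c • f)) = c • creation γ ε μ (creation γ ε' ν f) := by
  rw [creation_smul ε' ν c hf, creation_smul ε μ c (creation_mem ε' ν hf)]

theorem creation_plus_minus_comm {γ : ℝ} (μ ν : ℂ) {N : ℕ} {f : Fun N} (hf : f ∈ zSpan γ N) :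
    creation γ .plus μ (creation γ .minus ν f) = creation γ .minus ν (creation γ .plus μ f) := by
  induction hf using Submodule.span_induction with
  | mem f h =>
    obtain ⟨l, rfl⟩ := h
    simp only [creation_psi, adjoin, Fin.cons_snoc_eq_snoc_cons]
  | zero => simp only [creation_zero]
  | add f g hf hg h h' => simp only [creation_creation_add _ _ _ _ hf hg, h, h']
  | smul c f hf h => simp only [creation_creation_smul _ _ _ _ _ hf, h]

theorem creation_exchange {γ : ℝ} (ε : Sgn) {μ ν : ℂ} (hμν : μ ≠ ν) {N : ℕ} {f : Fun N}
    (hf : f ∈ zSpan γ N) :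
    permAct (edgeSwap N ε) (creation γ ε μ (creation γ ε ν f)) -
        creation γ ε ν (creation γ ε μ f) =
      (-ε.val * Complex.I * (γ : ℂ) / (μ - ν)) •
        (creation γ ε μ (creation γ ε ν f) - creation γ ε ν (creation γ ε μ f)) := by
  funext x
  induction hf using Submodule.span_induction with
  | mem f h =>
    obtain ⟨l, rfl⟩ := h
    have h := psi_exchange γ (edgePair N ε) (adjoin ε μ (adjoin ε ν l)) x
    rw [adjoin_adjoin_edgePair, simpleSwap_edgePair, adjoin_adjoin_comp_edgeSwap] at h
    simp only [creation_psi, Pi.sub_apply, Pi.smul_apply, smul_eq_mul]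
    have hd : μ - ν ≠ 0 := sub_ne_zero.2 hμν
    have hε : ε.val * ε.val = 1 := by cases ε <;> simp [Sgn.val]
    field_simp
    linear_combination ε.val * h - (μ - ν) * (permAct (edgeSwap N ε)
      (psi γ (adjoin ε μ (adjoin ε ν l))) x - psi γ (adjoin ε ν (adjoin ε μ l)) x) * hε
  | zero => simp [creation_zero, permAct]
  | add f g hf hg h h' =>
    simp only [creation_creation_add _ _ _ _ hf hg, Pi.sub_apply, Pi.add_apply, Pi.smul_apply,
      smul_eq_mul, permAct] at h h' ⊢
    linear_combination h + h'
  | smul c f hf h =>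
    simp only [creation_creation_smul _ _ _ _ _ hf, Pi.sub_apply, Pi.smul_apply,
      smul_eq_mul, permAct] at h ⊢
    linear_combination c * h

theorem exists_tendsto_commutator_psi (γ : ℝ) (ε : Sgn) (μ : ℂ) {N : ℕ} (l : Fin N → ℂ) :
    ∃ L : Fun (N + 2),
      TendstoLocallyUniformly
        (fun (ν : ℂ) (x : Fin (N + 2) → ℝ) =>
          (creation γ ε μ (creation γ ε ν (psi γ l)) x -
            creation γ ε ν (creation γ ε μ (psi γ l)) x) / (μ - ν))
        L (𝓝[≠] μ) ∧
      permAct (edgeSwap N ε) (creation γ ε μ (creation γ ε μ (psi γ l))) -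
          creation γ ε μ (creation γ ε μ (psi γ l)) =
        (-ε.val * Complex.I * (γ : ℂ)) • L := by
  set p := edgePair N ε
  -- By `psi_sub_psi_comp_swap`, $P^\gamma$ of this function is the divided commutator for
  -- $\nu\ne\mu$, and it still makes sense at $\nu=\mu$.
  let F : ℂ → Fun (N + 2) := fun ν => (ε.val * Complex.I) •
    intOp p.1.1 p.1.2 (planeWave (adjoin ε μ (adjoin ε ν l)))
  have hl : Continuous fun q : ℂ × (Fin (N + 2) → ℝ) => adjoin ε μ (adjoin ε q.1 l) :=
    (continuous_adjoin_adjoin ε μ l).comp continuous_fst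
  have hF : Continuous fun q : ℂ × (Fin (N + 2) → ℝ) => F q.1 q.2 :=
    continuous_const.mul (continuous_intOp p.1.1 p.1.2
      (F := fun ν => planeWave (adjoin ε μ (adjoin ε ν l))) (continuous_planeWave hl continuous_snd))
  have hquot : ∀ ν, ν ≠ μ → ∀ x, (creation γ ε μ (creation γ ε ν (psi γ l)) x -
      creation γ ε ν (creation γ ε μ (psi γ l)) x) / (μ - ν) = propagation γ (F ν) x := by
    intro ν hν x
    have h := congrFun (psi_sub_psi_comp_swap γ p (adjoin ε μ (adjoin ε ν l))) x
    rw [adjoin_adjoin_edgePair, simpleSwap_edgePair, adjoin_adjoin_comp_edgeSwap] at h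
    simp only [Pi.sub_apply, Pi.smul_apply, smul_eq_mul] at h
    have hd : μ - ν ≠ 0 := sub_ne_zero.2 hν.symm
    rw [creation_psi, creation_psi, creation_psi, creation_psi, h, propagation_smul, Pi.smul_apply,
      smul_eq_mul]
    field_simp
  have hT : TendstoLocallyUniformly
      (fun (ν : ℂ) (x : Fin (N + 2) → ℝ) =>
        (creation γ ε μ (creation γ ε ν (psi γ l)) x -
          creation γ ε ν (creation γ ε μ (psi γ l)) x) / (μ - ν))
      (propagation γ (F μ)) (𝓝[≠] μ) := by
    rw [tendstoLocallyUniformly_iff_forall_tendsto]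
    intro x
    refine (((tendstoLocallyUniformly_iff_forall_tendsto.1
      (tendstoLocallyUniformly_propagation γ hF μ) x).mono_left
        (Filter.prod_mono_left _ nhdsWithin_le_nhds))).congr' ?_
    have hne : ∀ᶠ ν in 𝓝[≠] μ, ν ≠ μ := self_mem_nhdsWithin
    filter_upwards [hne.prod_inl (𝓝 x)] with y hy
    rw [hquot y.1 hy]
  refine ⟨_, hT, funext fun x => ?_⟩
  have hcont : Continuous fun ν =>
      permAct (edgeSwap N ε) (psi γ (adjoin ε μ (adjoin ε ν l))) x -
        psi γ (adjoin ε μ (adjoin ε ν l) ∘ edgeSwap N ε) x := by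
    have h1 := continuous_adjoin_adjoin ε μ l
    have h2 : Continuous fun ν => adjoin ε μ (adjoin ε ν l) ∘ edgeSwap N ε := by
      unfold comp
      fun_prop
    simp only [psi_eq_minusWave, permAct]
    exact ((continuous_minusWave γ _).comp (h1.prodMk continuous_const)).sub
      ((continuous_minusWave γ _).comp (h2.prodMk continuous_const))
  -- Both sides of the relation for $\nu\ne\mu$ converge as $\nu\to\mu$; uniqueness of limits gives
  -- the relation at $\nu=\mu$.
  have hlim := (hcont.tendsto μ).mono_left (nhdsWithin_le_nhds (s := {μ}ᶜ))
  have hx : Tendsto _ (𝓝[≠] μ) (𝓝 (propagation γ (F μ) x)) :=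
    hT.tendstoLocallyUniformlyOn.tendsto_at (Set.mem_univ x)
  have hlim' := (hx.const_mul (-ε.val * Complex.I * (γ : ℂ))).congr' (f₂ := fun ν =>
      permAct (edgeSwap N ε) (psi γ (adjoin ε μ (adjoin ε ν l))) x -
        psi γ (adjoin ε μ (adjoin ε ν l) ∘ edgeSwap N ε) x) (by
    filter_upwards [self_mem_nhdsWithin] with ν hν
    have h := congrFun (creation_exchange ε (Ne.symm hν)
      (Submodule.subset_span ⟨l, rfl⟩ : psi γ l ∈ zSpan γ N)) x
    rw [adjoin_adjoin_comp_edgeSwap]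
    simp only [creation_psi, Pi.sub_apply, Pi.smul_apply, smul_eq_mul] at h ⊢
    rw [h]
    ring)
  have := tendsto_nhds_unique hlim hlim'
  rw [adjoin_adjoin_comp_edgeSwap] at this
  simpa only [creation_psi, Pi.sub_apply, Pi.smul_apply, smul_eq_mul] using this

theorem exists_tendsto_commutator {γ : ℝ} (ε : Sgn) (μ : ℂ) {N : ℕ} {f : Fun N}
    (hf : f ∈ zSpan γ N) :
    ∃ L : Fun (N + 2),
      TendstoLocallyUniformly
        (fun (ν : ℂ) (x : Fin (N + 2) → ℝ) =>
          (creation γ ε μ (creation γ ε ν f) x -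
            creation γ ε ν (creation γ ε μ f) x) / (μ - ν))
        L (𝓝[≠] μ) ∧
      permAct (edgeSwap N ε) (creation γ ε μ (creation γ ε μ f)) -
          creation γ ε μ (creation γ ε μ f) =
        (-ε.val * Complex.I * (γ : ℂ)) • L := by
  induction hf using Submodule.span_induction with
  | mem f h =>
    obtain ⟨l, rfl⟩ := h
    exact exists_tendsto_commutator_psi γ ε μ l
  | zero =>
    refine ⟨0, ?_, by simp [creation_zero]; rfl⟩
    simp only [creation_zero, Pi.zero_apply, sub_zero, zero_div]
    exact fun u hu x => ⟨Set.univ, univ_mem,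
      Eventually.of_forall fun _ _ _ => refl_mem_uniformity hu⟩
  | add f g hf hg h h' =>
    obtain ⟨L, hL, e⟩ := h
    obtain ⟨L', hL', e'⟩ := h'
    refine ⟨L + L', ?_, ?_⟩
    · convert hL.add hL' using 1
      funext ν x
      simp only [creation_creation_add _ _ _ _ hf hg, Pi.add_apply]
      ring
    · rw [smul_add, ← e, ← e', creation_creation_add _ _ _ _ hf hg]
      exact add_sub_add_comm _ _ _ _
  | smul c f hf h =>
    obtain ⟨L, hL, e⟩ := h
    refine ⟨c • L, ?_, ?_⟩
    · convert (uniformContinuous_const_smul c).comp_tendstoLocallyUniformly hL using 1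
      · funext ν x
        simp only [creation_creation_smul _ _ _ _ _ hf, Pi.smul_apply, smul_eq_mul, comp_apply]
        ring
      · rfl
    · rw [smul_comm, ← e, creation_creation_smul _ _ _ _ _ hf, smul_sub]
      rfl

end QNLS

theorem mainTheorem4 (γ : ℝ) (N : ℕ) :
    -- each `b^ε_μ` restricts to a linear map from `𝔷_M` to `𝔷_{M+1}`
    (∀ (M : ℕ) (ε : QNLS.Sgn) (μ : ℂ),
      ∃ T : QNLS.zSpan γ M →ₗ[ℂ] QNLS.zSpan γ (M + 1),
        ∀ f : QNLS.zSpan γ M, (T f : QNLS.Fun (M + 1)) = QNLS.creation γ ε μ (f : QNLS.Fun M)) ∧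
    -- creation operators of opposite signs commute
    (∀ μ ν : ℂ, ∀ f ∈ QNLS.zSpan γ N,
      QNLS.creation γ .plus μ (QNLS.creation γ .minus ν f) =
        QNLS.creation γ .minus ν (QNLS.creation γ .plus μ f)) ∧
    -- creation operators of the same sign, `μ ≠ ν`
    (∀ (ε : QNLS.Sgn) (μ ν : ℂ), μ ≠ ν → ∀ f ∈ QNLS.zSpan γ N,
      QNLS.permAct (QNLS.edgeSwap N ε)
          (QNLS.creation γ ε μ (QNLS.creation γ ε ν f)) ∈ QNLS.zSpan γ (N + 2) ∧
      QNLS.permAct (QNLS.edgeSwap N ε)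
          (QNLS.creation γ ε μ (QNLS.creation γ ε ν f)) -
          QNLS.creation γ ε ν (QNLS.creation γ ε μ f) =
        (-ε.val * Complex.I * (γ : ℂ) / (μ - ν)) •
          (QNLS.creation γ ε μ (QNLS.creation γ ε ν f) -
            QNLS.creation γ ε ν (QNLS.creation γ ε μ f))) ∧
    -- creation operators of the same sign, `μ = ν`
    (∀ (ε : QNLS.Sgn) (μ : ℂ), ∀ f ∈ QNLS.zSpan γ N,
      ∃ L : QNLS.Fun (N + 2),
        TendstoLocallyUniformly
          (fun (ν : ℂ) (x : Fin (N + 2) → ℝ) =>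
            (QNLS.creation γ ε μ (QNLS.creation γ ε ν f) x -
              QNLS.creation γ ε ν (QNLS.creation γ ε μ f) x) / (μ - ν))
          L (𝓝[≠] μ) ∧
        QNLS.permAct (QNLS.edgeSwap N ε)
            (QNLS.creation γ ε μ (QNLS.creation γ ε μ f)) -
            QNLS.creation γ ε μ (QNLS.creation γ ε μ f) =
          (-ε.val * Complex.I * (γ : ℂ)) • L) := by
  refine ⟨fun M ε μ => ⟨{
      toFun := fun f => ⟨QNLS.creation γ ε μ f, QNLS.creation_mem ε μ f.2⟩
      map_add' := fun f g => Subtype.ext (QNLS.creation_add ε μ f.2 g.2)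
      map_smul' := fun c f => Subtype.ext (QNLS.creation_smul ε μ c f.2) }, fun _ => rfl⟩,
    fun μ ν f hf => QNLS.creation_plus_minus_comm μ ν hf,
    fun ε μ ν hμν f hf => ?_,
    fun ε μ f hf => QNLS.exists_tendsto_commutator ε μ hf⟩
  have h := QNLS.creation_exchange ε hμν hf
  refine ⟨?_, h⟩
  -- Membership comes from the relation itself, which writes the permuted function as a combination
  -- of the two products.
  rw [sub_eq_iff_eq_add] at h
  have h1 := QNLS.creation_mem ε μ (QNLS.creation_mem ε ν hf)
  have h2 := QNLS.creation_mem ε ν (QNLS.creation_mem ε μ hf)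
  rw [h]
  exact add_mem (Submodule.smul_mem _ _ (sub_mem h1 h2)) h2
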